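/- Let $p$ be a prime, $\overline{\mathbb Q}_p$ an algebraic closure of $\mathbb Q_p$ and $\overline{\mathfrak m}$ the maximal ideal of its ring of integers. Let $h_1,h_2\ge 1$ be coprime integers and define $2\times2$ matrices over $\mathbb Q_p$ by $$s_i=\delta_{i,h_1}\begin{pmatrix}0&p^{-1}\\0&0\end{pmatrix}+\delta_{i,h_2}\begin{pmatrix}0&0\\p^{-1}&0\end{pmatrix}\qquad(i\ge1).$$ For a pair $g(X)\in\mathbb Z_p[[X]]^2$, $X=(x_1,x_2)$, without constant term, let $L_g\in\mathbb Q_p[[X]]^2$ be the unique pair without constant term such that $$L_g(X)=g(X)+\sum_{i\ge1}s_i\,L_g(x_1^{p^i},x_2^{p^i});$$ one says that $L_g$ satisfies a functional equation of type $(s_i)_{i\ge1}$. Let $L=L_X$ (the case $g(X)=X$), and let $L_\gamma$ satisfy a functional equation of the same type $(s_i)_{i\ge1}$, where $\gamma\in\mathbb Z_p[[X]]^2$ has no constant term and its Jacobian matrix at $0$ (which is that of $L_\gamma$) is invertible over $\mathbb Z_p$ (for instance the identity). Let $$F(X,Y)=L^{-1}(L(X)+L(Y)),\qquad G(X,Y)=L_\gamma^{-1}(L_\gamma(X)+L_\gamma(Y)),$$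 where $L^{-1},L_\gamma^{-1}$ denote inverses for composition of power series. Then these inverses exist, $F$ and $G$ have coefficients in $\mathbb Z_p$ and are $2$-dimensional formal groups over $\mathbb Z_p$ (the $2$-dimensional Lubin–Tate formal groups with logarithms $L$ and $L_\gamma$), and $\varphi=L_\gamma^{-1}\circ L$ has coefficients in $\mathbb Z_p$ and is an isomorphism of formal groups $F\to G$ over $\mathbb Z_p$. Consequently, for every integer $n\ge0$, put $F[p^n]=\{x\in\overline{\mathfrak m}^2 : [p^n]_F(x)=0\}$, where $[0]_F(X)=0$ and $[k+1]_F(X)=F(X,[k]_F(X))$, and define $G[p^n]$ likewise. Then $F[p^n]$ is a $\mathbb Z_p$-module for $x+y=F(x,y)$ and $a\cdot x=[a]_F(x)$ with $[a]_F=L^{-1}(aL)$ $(a\in\mathbb Z_p)$, $G[p^n]$ is a $\mathbb Z_p$-module in the same way with $G$ and $L_\gamma$, and $x\mapsto\varphi(x)$ is an isomorphism of $\mathbb Z_p$-modules $F[p^n]\cong G[p^n]$. -/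

import Mathlib

open MvPowerSeries

namespace LubinTateTwo

/-! ### Tuples of power series and formal groups -/

section FormalGroups

variable {ι κ τ : Type} {R : Type*} [CommRing R]

/-- Composition `f(a)` of a tuple `f` of power series in the variables `κ` with a `κ`-indexed tuple
`a` of power series in the variables `τ`. It is used only when the `a j` have no constant term. -/
noncomputable def comp (f : ι → MvPowerSeries κ R) (a : κ → MvPowerSeries τ R) :
    ι → MvPowerSeries τ R :=
  fun k => (f k).subst a

/-- The Jacobian matrix at `0` of a tuple of power series. -/
noncomputable def jacobian (f : ι → MvPowerSeries κ R) : Matrix ι κ R :=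
  Matrix.of fun k j => coeff (Finsupp.single j 1) (f k)

/-- `m` is the inverse of `l` for composition. -/
def IsCompInverse (l m : ι → MvPowerSeries ι R) : Prop :=
  (∀ k, constantCoeff (l k) = 0) ∧ (∀ k, constantCoeff (m k) = 0) ∧
    comp l m = X ∧ comp m l = X

open Classical in
/-- The inverse `l⁻¹` of `l` for composition (the value `0` is used when there is none). -/
noncomputable def compInv (l : ι → MvPowerSeries ι R) : ι → MvPowerSeries ι R :=
  if h : ∃ m, IsCompInverse l m then h.choose else 0

/-- `F(X, Y)`, where `X` is `Sum.inl` and `Y` is `Sum.inr`, is a formal group over `R`. -/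
structure IsFormalGroup (F : ι → MvPowerSeries (ι ⊕ ι) R) : Prop where
  /-- `F(X, Y) = X + Y` modulo terms of degree at least two. -/
  linear : ∀ k (d : ι ⊕ ι →₀ ℕ), d.degree < 2 →
    coeff d (F k) = coeff d (X (Sum.inl k) + X (Sum.inr k) : MvPowerSeries (ι ⊕ ι) R)
  /-- `F(F(X, Y), Z) = F(X, F(Y, Z))`. -/
  assoc :
    comp F (Sum.elim
        (comp F (Sum.elim (fun j => X (Sum.inl j)) (fun j => X (Sum.inr (Sum.inl j)))))
        (fun j => X (Sum.inr (Sum.inr j)))) =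
      comp F (Sum.elim
        (fun j => (X (Sum.inl j) : MvPowerSeries (ι ⊕ ι ⊕ ι) R))
        (comp F (Sum.elim (fun j => X (Sum.inr (Sum.inl j))) (fun j => X (Sum.inr (Sum.inr j))))))
  /-- `F(X, 0) = X`. -/
  right_id : comp F (Sum.elim (X : ι → MvPowerSeries ι R) 0) = X
  /-- `F(0, X) = X`. -/
  left_id : comp F (Sum.elim 0 (X : ι → MvPowerSeries ι R)) = X
  /-- There is a unique tuple `ν(X)` with `F(X, ν(X)) = 0 = F(ν(X), X)`. -/
  inverse : ∃! ν : ι → MvPowerSeries ι R, (∀ k, constantCoeff (ν k) = 0) ∧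
    comp F (Sum.elim X ν) = 0 ∧ comp F (Sum.elim ν X) = 0

/-- `f : F → G` is a homomorphism of formal groups: `f` has no constant term and
`f(F(X, Y)) = G(f(X), f(Y))`. -/
def IsHom (F : ι → MvPowerSeries (ι ⊕ ι) R) (G : κ → MvPowerSeries (κ ⊕ κ) R)
    (f : κ → MvPowerSeries ι R) : Prop :=
  (∀ k, constantCoeff (f k) = 0) ∧
    comp f F = comp G (Sum.elim (comp f fun j => X (Sum.inl j)) (comp f fun j => X (Sum.inr j)))

/-- `f : F → G` is an isomorphism of formal groups over `R`. -/
def IsIso (F G : ι → MvPowerSeries (ι ⊕ ι) R) (f : ι → MvPowerSeries ι R) : Prop :=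
  IsHom F G f ∧ ∃ g : ι → MvPowerSeries ι R, IsHom G F g ∧ comp f g = X ∧ comp g f = X

/-- The multiplication `[k]_F`: `[0]_F(X) = 0` and `[k+1]_F(X) = F(X, [k]_F(X))`. -/
noncomputable def nmul (F : ι → MvPowerSeries (ι ⊕ ι) R) : ℕ → ι → MvPowerSeries ι R
  | 0 => 0
  | k + 1 => comp F (Sum.elim X (nmul F k))

/-- The tuple `L⁻¹(L(X) + L(Y))`. -/
noncomputable def ofLog (L : ι → MvPowerSeries ι R) : ι → MvPowerSeries (ι ⊕ ι) R :=
  comp (compInv L) ((comp L fun j => X (Sum.inl j)) + comp L fun j => X (Sum.inr j))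

/-- The tuple `[a](X) = L⁻¹(a L(X))`. -/
noncomputable def logMul (L : ι → MvPowerSeries ι R) (a : R) : ι → MvPowerSeries ι R :=
  comp (compInv L) (a • L)

end FormalGroups

/-! ### Functional equations over `ℤ_[p]` -/

section FunctionalEquation

variable (p : ℕ) [hp : Fact p.Prime] {ι κ : Type} [Fintype ι]

/-- A tuple of power series over `ℤ_[p]`, viewed over `ℚ_[p]`. -/
noncomputable def toQp (g : ι → MvPowerSeries κ ℤ_[p]) : ι → MvPowerSeries κ ℚ_[p] :=
  fun k => (g k).map PadicInt.Coe.ringHom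

/-- The tuple `L(X ^ (p ^ i))`. -/
noncomputable def frobExpand (i : ℕ) (L : ι → MvPowerSeries κ ℚ_[p]) :
    ι → MvPowerSeries κ ℚ_[p] :=
  fun k => expand (p ^ i) (pow_ne_zero i hp.out.ne_zero) (L k)

/-- The tuples `g` (over `ℤ_[p]`) and `L` (over `ℚ_[p]`) have no constant term and satisfy
`L(X) = g(X) + ∑_{i ≥ 1} s_i L(X ^ (p ^ i))`. The sum is taken coefficient by coefficient; since `L`
has no constant term, only finitely many summands contribute to a given coefficient. -/
structure FunctionalEquation (s : ℕ → Matrix ι ι ℚ_[p]) (g : ι → MvPowerSeries κ ℤ_[p])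
    (L : ι → MvPowerSeries κ ℚ_[p]) : Prop where
  const_g : ∀ k, constantCoeff (g k) = 0
  const_L : ∀ k, constantCoeff (L k) = 0
  eqn : ∀ k d, coeff d (L k) = coeff d (toQp p g k) +
    ∑ᶠ (i : ℕ) (_ : 1 ≤ i), ∑ j, s i k j * coeff d (frobExpand p i L j)

/-- Division of a multi-exponent by `N`. -/
noncomputable def divExp (d : κ →₀ ℕ) (N : ℕ) : κ →₀ ℕ :=
  d.mapRange (fun m => m / N) (Nat.zero_div N)

theorem degree_divExp_lt {d : κ →₀ ℕ} (hd : d ≠ 0) {N : ℕ} (hN : 1 < N) :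
    (divExp d N).degree < d.degree := by
  classical
  have hsub : (divExp d N).support ⊆ d.support := Finsupp.support_mapRange
  have hne : d.support.Nonempty := Finsupp.support_nonempty_iff.mpr hd
  have h1 : (divExp d N).degree = ∑ j ∈ d.support, d j / N := by
    rw [Finsupp.degree]
    refine Finset.sum_subset hsub ?_
    intro j _ hj
    have h2 : (divExp d N) j = 0 := Finsupp.notMem_support_iff.mp hj
    exact h2
  rw [h1, Finsupp.degree]
  refine Finset.sum_lt_sum_of_nonempty hne fun j hj => ?_
  exact Nat.div_lt_self (Nat.pos_of_ne_zero (Finsupp.mem_support_iff.mp hj)) hN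

open Classical in
/-- The coefficients of the solution of the functional equation, by recursion on the degree. -/
noncomputable def logCoeff (s : ℕ → Matrix ι ι ℚ_[p]) (g : ι → MvPowerSeries κ ℤ_[p])
    (d : κ →₀ ℕ) : ι → ℚ_[p] :=
  if _hd : d = 0 then 0
  else fun k => coeff d (toQp p g k) + ∑ i ∈ Finset.range d.degree,
    if ∀ j, p ^ (i + 1) ∣ d j then
      ∑ j, s (i + 1) k j * logCoeff s g (divExp d (p ^ (i + 1))) j
    else 0
termination_by d.degree
decreasing_by
  exact degree_divExp_lt _hd (Nat.one_lt_pow (Nat.succ_ne_zero i) hp.out.one_lt)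

/-- The tuple `L_g` defined by the functional equation with data `s` and `g`. -/
noncomputable def logSeries (s : ℕ → Matrix ι ι ℚ_[p]) (g : ι → MvPowerSeries κ ℤ_[p]) :
    ι → MvPowerSeries κ ℚ_[p] :=
  fun k d => logCoeff p s g d k

theorem coeff_logSeries (s : ℕ → Matrix ι ι ℚ_[p]) (g : ι → MvPowerSeries κ ℤ_[p])
    (k : ι) (d : κ →₀ ℕ) : coeff d (logSeries p s g k) = logCoeff p s g d k := rfl

open Classical in
theorem coeff_frobExpand (L : ι → MvPowerSeries κ ℚ_[p]) (i : ℕ) (k : ι) (d : κ →₀ ℕ) :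
    coeff d (frobExpand p i L k) =
      if ∀ j, p ^ i ∣ d j then coeff (divExp d (p ^ i)) (L k) else 0 := by
  split_ifs with h
  · have hd : d = p ^ i • divExp d (p ^ i) := by
      ext j
      simp [divExp, Nat.mul_div_cancel' (h j)]
    conv_lhs => rw [hd]
    exact coeff_expand_smul _ _ _ _
  · push Not at h
    obtain ⟨j, hj⟩ := h
    exact coeff_expand_of_not_dvd _ _ _ hj

open Classical in
/-- The sum in the functional equation is finite in each degree. -/
theorem finsum_frobExpand (s : ℕ → Matrix ι ι ℚ_[p]) (L : ι → MvPowerSeries κ ℚ_[p])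
    (k : ι) {d : κ →₀ ℕ} (hd : d ≠ 0) :
    (∑ᶠ (i : ℕ) (_ : 1 ≤ i), ∑ j, s i k j * coeff d (frobExpand p i L j)) =
      ∑ i ∈ Finset.range d.degree, if ∀ j, p ^ (i + 1) ∣ d j then
        ∑ j, s (i + 1) k j * coeff (divExp d (p ^ (i + 1))) (L j) else 0 := by
  have key : ∀ i, d.degree < i → ¬ ∀ j, p ^ i ∣ d j := by
    intro i hi hall
    obtain ⟨j, hj⟩ := Finsupp.ne_iff.mp hd
    have h1 := Nat.le_of_dvd (Nat.pos_of_ne_zero hj) (hall j)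
    have h2 : i < p ^ i := Nat.lt_pow_self hp.out.one_lt
    have h3 : d j ≤ d.degree := Finsupp.le_degree j d
    omega
  refine (finsum_mem_eq_sum_of_inter_support_eq (s := {i : ℕ | 1 ≤ i})
    (t := Finset.Icc 1 d.degree) (fun i => ∑ j, s i k j * coeff d (frobExpand p i L j)) ?_).trans ?_
  swap
  · rw [Finset.range_eq_Ico, Finset.sum_Ico_add' (fun i => if ∀ j, p ^ i ∣ d j then
        ∑ j, s i k j * coeff (divExp d (p ^ i)) (L j) else 0) 0 d.degree 1]
    refine Finset.sum_congr (by ext; simp) fun i _ => ?_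
    simp only [coeff_frobExpand]
    split_ifs <;> simp
  · ext i
    simp only [Set.mem_inter_iff, Set.mem_ofPred_eq, Function.mem_support, Finset.coe_Icc,
      Set.mem_Icc]
    refine ⟨fun h => ⟨⟨h.1, ?_⟩, h.2⟩, fun h => ⟨h.1.1, h.2⟩⟩
    by_contra hlt
    apply h.2
    simp only [coeff_frobExpand]
    simp only [if_neg (key i (by omega))]
    simp

/-- `L_g` satisfies the functional equation that defines it. -/
theorem functionalEquation_logSeries (s : ℕ → Matrix ι ι ℚ_[p]) (g : ι → MvPowerSeries κ ℤ_[p])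
    (hg : ∀ k, constantCoeff (g k) = 0) : FunctionalEquation p s g (logSeries p s g) := by
  have h0 : ∀ k, coeff 0 (logSeries p s g k) = 0 := by
    intro k
    rw [coeff_logSeries, logCoeff]
    simp
  refine ⟨hg, fun k => by rw [← coeff_zero_eq_constantCoeff_apply]; exact h0 k, fun k d => ?_⟩
  by_cases hd : d = 0
  · subst hd
    have h1 : ∀ i j, coeff 0 (frobExpand p i (logSeries p s g) j) = 0 := by
      intro i j
      rw [coeff_frobExpand]
      have : divExp (0 : κ →₀ ℕ) (p ^ i) = 0 := by simp [divExp]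
      simp [this, h0]
    have h2 : coeff 0 (toQp p g k) = 0 := by
      simp [toQp, hg]
    rw [h0, h2]
    simp [h1]
  · rw [finsum_frobExpand p s _ k hd, coeff_logSeries, logCoeff, dif_neg hd]
    rfl

/-- The solution of the functional equation is unique. -/
theorem FunctionalEquation.eq_logSeries {s : ℕ → Matrix ι ι ℚ_[p]}
    {g : ι → MvPowerSeries κ ℤ_[p]} {L : ι → MvPowerSeries κ ℚ_[p]}
    (h : FunctionalEquation p s g L) : L = logSeries p s g := by
  have main : ∀ n (d : κ →₀ ℕ), d.degree = n →
      ∀ k, coeff d (L k) = coeff d (logSeries p s g k) := by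
    intro n
    induction n using Nat.strong_induction_on with
    | _ n ih =>
      intro d hdn k
      have h' := functionalEquation_logSeries p s g h.const_g
      by_cases hd : d = 0
      · subst hd
        rw [coeff_zero_eq_constantCoeff_apply, coeff_zero_eq_constantCoeff_apply, h.const_L,
          h'.const_L]
      · rw [h.eqn, h'.eqn, finsum_frobExpand p s _ k hd, finsum_frobExpand p s _ k hd]
        congr 1
        refine Finset.sum_congr rfl fun i _ => ?_
        split_ifs
        · refine Finset.sum_congr rfl fun j _ => ?_
          rw [ih _ (hdn ▸ degree_divExp_lt hd
            (Nat.one_lt_pow (Nat.succ_ne_zero i) hp.out.one_lt)) _ rfl]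
        · rfl
  funext k
  ext d
  exact main _ d rfl k

end FunctionalEquation

/-! ### The two-dimensional Lubin-Tate logarithm -/

section LubinTate

variable (p : ℕ) [hp : Fact p.Prime]

/-- The matrices `s_i`: `s_{h₁}` has the single entry `p⁻¹` in position `(1, 2)`, `s_{h₂}` has the
single entry `p⁻¹` in position `(2, 1)`, and the other `s_i` vanish. (If `h₁ = h₂ = 1`, then `s_1` is
the sum of the two matrices.) -/
noncomputable def ltMatrix (h₁ h₂ : ℕ) (i : ℕ) : Matrix (Fin 2) (Fin 2) ℚ_[p] :=
  (if i = h₁ then !![0, (p : ℚ_[p])⁻¹; 0, 0] else 0) +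
    (if i = h₂ then !![0, 0; (p : ℚ_[p])⁻¹, 0] else 0)

/-- The logarithm `L = L_g` of the Lubin-Tate formal group, for `g(X) = X`. -/
noncomputable def ltLog (h₁ h₂ : ℕ) : Fin 2 → MvPowerSeries (Fin 2) ℚ_[p] :=
  logSeries p (ltMatrix p h₁ h₂) (X : Fin 2 → MvPowerSeries (Fin 2) ℤ_[p])

/-! ### Torsion points -/

/-- The value at `x` of a tuple of power series over `ℚ_[p]`, as a convergent sum in the algebraic
closure of `ℚ_[p]` with its `p`-adic norm. It is used only for coefficients in `ℤ_[p]` and for points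
with coordinates in the maximal ideal, where it converges, as the coordinates of `x` lie in a finite
extension of `ℚ_[p]`, which is complete. -/
noncomputable def evalTuple {ι κ : Type} (f : ι → MvPowerSeries κ ℚ_[p])
    (x : κ → PadicAlgCl p) : ι → PadicAlgCl p :=
  fun k => ∑' d : κ →₀ ℕ,
    algebraMap ℚ_[p] (PadicAlgCl p) (coeff d (f k)) * d.prod fun j m => x j ^ m

/-- The `p ^ n`-torsion points of `F`: the pairs `x` of elements of the maximal ideal of the
ring of integers of the algebraic closure of `ℚ_[p]` such that `[p ^ n]_F(x) = 0`. -/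
def torsion (F : Fin 2 → MvPowerSeries (Fin 2 ⊕ Fin 2) ℤ_[p]) (n : ℕ) :
    Set (Fin 2 → PadicAlgCl p) :=
  {x | (∀ j, ‖x j‖ < 1) ∧ evalTuple p (toQp p (nmul F (p ^ n))) x = 0}

/-- The given `ℤ_[p]`-module structure on the `p ^ n`-torsion points of the formal group `F` with
logarithm `L` is the one with `x + y = F(x, y)` and `a • x = [a]_F(x)`, where
`[a]_F(X) = L⁻¹(a L(X))`. -/
def IsTorsionModule (F : Fin 2 → MvPowerSeries (Fin 2 ⊕ Fin 2) ℤ_[p])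
    (L : Fin 2 → MvPowerSeries (Fin 2) ℚ_[p]) (n : ℕ)
    [AddCommGroup (torsion p F n)] [Module ℤ_[p] (torsion p F n)] : Prop :=
  (∀ x y : torsion p F n, ((x + y : torsion p F n) : Fin 2 → PadicAlgCl p) =
      evalTuple p (toQp p F) (Sum.elim x.1 y.1)) ∧
    ∀ (a : ℤ_[p]) (x : torsion p F n), ((a • x : torsion p F n) : Fin 2 → PadicAlgCl p) =
      evalTuple p (logMul L (a : ℚ_[p])) x.1

end LubinTate

end LubinTateTwo

/-! The theorem is an instance of Hazewinkel's functional equation lemma. Say that a tuple `f` over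
`ℚ_[p]` without constant term has type `s` if `f - ∑ s_i f(X ^ (p ^ i))` is integral; here each `p
s_i` is integral. Two facts carry the argument.

(1) If `L` has type `s` and `m` is integral without constant term, then `L(m)` has type `s`
(`HasTypeWith.comp_toQp`). The defect is a sum of terms `s_i (L(m ^ (p ^ i)) - L(m(X ^ (p ^ i))))`,
and the two arguments of `L` are congruent modulo `p`. If `p ^ t` is the exact power of `p` dividing
the exponent `d`, the coefficient of `L` at `d` has denominator at most `p ^ t`, while `p ^ t`-th
powers of elements congruent modulo `p` are congruent modulo `p ^ (t + 1)`. So the difference is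
divisible by `p`, which absorbs the denominator of `s_i`.

(2) If moreover the Jacobian is invertible over `ℤ_[p]`, then `L⁻¹(f)` is integral for every `f` of
type `s` (`HasTypeWith.exists_comp_toQp_eq`). This goes degree by degree: the lowest-order part of a
typed series is integral, because the Frobenius terms begin in higher degree.

Series of type `s` are closed under sums and `ℤ_[p]`-multiples, so (2) makes `L⁻¹(L(X) + L(Y))`,
`L⁻¹(aL)`, `Lγ⁻¹(L)` and `L⁻¹(Lγ)` integral. Identities between them are checked after applying the
logarithm, which is injective on tuples without constant term and turns the group law into addition.

On points, integral series converge in the finite extension generated by the coordinates, and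
evaluation commutes with composition. The formal identities thus become the module axioms on the
open polydisc and make `φ` a linear bijection, which matches the kernels of `p ^ n`. -/

namespace LubinTateTwo

/-! ### Formal composition of tuples. -/

section Composition

variable {ι κ τ υ : Type} {R : Type*} [CommRing R]

/-- All members of the tuple have constant term zero. -/
def ZeroConst (f : ι → MvPowerSeries κ R) : Prop := ∀ k, constantCoeff (f k) = 0

theorem ZeroConst.hasSubst [Finite κ] {a : κ → MvPowerSeries τ R} (ha : ZeroConst a) :
    HasSubst a := hasSubst_of_constantCoeff_zero ha

theorem ZeroConst.comp [Finite κ] {f : ι → MvPowerSeries κ R} {a : κ → MvPowerSeries τ R}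
    (hf : ZeroConst f) (ha : ZeroConst a) : ZeroConst (comp f a) :=
  fun k => constantCoeff_subst_eq_zero ha.hasSubst ha (hf k)

theorem ZeroConst.add {f g : ι → MvPowerSeries κ R} (hf : ZeroConst f) (hg : ZeroConst g) :
    ZeroConst (f + g) := fun k => by simp [hf k, hg k]

theorem ZeroConst.sub {f g : ι → MvPowerSeries κ R} (hf : ZeroConst f) (hg : ZeroConst g) :
    ZeroConst (f - g) := fun k => by simp [hf k, hg k]

theorem ZeroConst.smul {f : ι → MvPowerSeries κ R} (hf : ZeroConst f) (a : R) :
    ZeroConst (a • f) := fun k => by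
  simp [← coeff_zero_eq_constantCoeff_apply, show coeff 0 (f k) = 0 from hf k]

theorem zeroConst_zero : ZeroConst (0 : ι → MvPowerSeries κ R) := fun k => by simp

theorem zeroConst_X : ZeroConst (X : ι → MvPowerSeries ι R) := fun k => by simp

theorem zeroConst_X_comp (e : ι → κ) : ZeroConst (fun j => (X (e j) : MvPowerSeries κ R)) :=
  fun k => by simp

theorem ZeroConst.sumElim {f : ι → MvPowerSeries τ R} {g : κ → MvPowerSeries τ R}
    (hf : ZeroConst f) (hg : ZeroConst g) : ZeroConst (Sum.elim f g) := by
  rintro (k | k)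
  exacts [hf k, hg k]

theorem comp_comp [Finite κ] [Finite τ] (f : ι → MvPowerSeries κ R) {a : κ → MvPowerSeries τ R}
    {b : τ → MvPowerSeries υ R} (ha : ZeroConst a) (hb : ZeroConst b) :
    comp (comp f a) b = comp f (comp a b) :=
  funext fun k => subst_comp_subst_apply ha.hasSubst hb.hasSubst (f k)

theorem comp_X (f : ι → MvPowerSeries κ R) : comp f X = f := by
  funext k
  simp [comp, subst_self]

theorem X_comp [Finite κ] {a : κ → MvPowerSeries τ R} (ha : ZeroConst a) :
    comp X a = a := funext fun k => subst_X ha.hasSubst k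

theorem comp_variables [Finite κ] (e : ι → κ) {a : κ → MvPowerSeries τ R} (ha : ZeroConst a) :
    comp (fun j => X (e j)) a = a ∘ e := funext fun k => subst_X ha.hasSubst (e k)

theorem comp_add [Finite κ] (f g : ι → MvPowerSeries κ R) {a : κ → MvPowerSeries τ R}
    (ha : ZeroConst a) : comp (f + g) a = comp f a + comp g a :=
  funext fun k => subst_add ha.hasSubst (f k) (g k)

theorem comp_smul [Finite κ] (r : R) (f : ι → MvPowerSeries κ R) {a : κ → MvPowerSeries τ R}
    (ha : ZeroConst a) : comp (r • f) a = r • comp f a :=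
  funext fun k => subst_smul ha.hasSubst r (f k)

theorem comp_zero {f : ι → MvPowerSeries κ R} (hf : ZeroConst f) :
    comp f (0 : κ → MvPowerSeries τ R) = 0 :=
  funext fun k => subst_zero_of_constantCoeff_zero (hf k)

/-- The product of a constant matrix with a tuple of power series. -/
noncomputable def matMul [Fintype ι] (A : Matrix ι ι R) (f : ι → MvPowerSeries κ R) :
    ι → MvPowerSeries κ R := fun k => ∑ j, A k j • f j

theorem matMul_add [Fintype ι] (A : Matrix ι ι R) (f g : ι → MvPowerSeries κ R) :
    matMul A (f + g) = matMul A f + matMul A g := by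
  funext k
  simp [matMul, Finset.sum_add_distrib]

theorem matMul_sub [Fintype ι] (A : Matrix ι ι R) (f g : ι → MvPowerSeries κ R) :
    matMul A (f - g) = matMul A f - matMul A g := by
  funext k
  simp [matMul, smul_sub, Finset.sum_sub_distrib]

theorem matMul_smul [Fintype ι] (A : Matrix ι ι R) (r : R) (f : ι → MvPowerSeries κ R) :
    matMul A (r • f) = r • matMul A f := by
  funext k
  simp [matMul, Finset.smul_sum, smul_comm r]

theorem matMul_matMul [Fintype ι] (A B : Matrix ι ι R) (f : ι → MvPowerSeries κ R) :
    matMul A (matMul B f) = matMul (A * B) f := by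
  funext k
  simp only [matMul, Matrix.mul_apply, Finset.smul_sum, Finset.sum_smul, smul_smul]
  exact Finset.sum_comm

theorem one_matMul [Fintype ι] [DecidableEq ι] (f : ι → MvPowerSeries κ R) :
    matMul 1 f = f := by
  funext k
  simp [matMul, Matrix.one_apply]

theorem ZeroConst.matMul [Fintype ι] {f : ι → MvPowerSeries κ R} (hf : ZeroConst f)
    (A : Matrix ι ι R) : ZeroConst (matMul A f) := fun k => by
  rw [LubinTateTwo.matMul, map_sum]
  exact Finset.sum_eq_zero fun j _ => hf.smul (A k j) j

theorem matMul_comp [Fintype ι] [Finite κ] (A : Matrix ι ι R) (f : ι → MvPowerSeries κ R)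
    {a : κ → MvPowerSeries τ R} (ha : ZeroConst a) :
    comp (matMul A f) a = matMul A (comp f a) := by
  funext k
  simp only [comp, matMul, ← substAlgHom_apply ha.hasSubst, map_sum, map_smul]

/-! ### The degree filtration and the formal inverse function theorem. -/

/-- The ideal of power series all of whose terms have total degree at least `n`. -/
def lowDegIdeal (κ : Type) (R : Type*) [CommRing R] (n : ℕ) : Ideal (MvPowerSeries κ R) where
  carrier := {f | ∀ d : κ →₀ ℕ, d.degree < n → coeff d f = 0}
  add_mem' hf hg d hd := by rw [map_add, hf d hd, hg d hd, add_zero]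
  zero_mem' d _ := by simp
  smul_mem' c f hf d hd := by
    classical
    rw [smul_eq_mul, coeff_mul]
    refine Finset.sum_eq_zero fun x hx => ?_
    rw [hf x.2, mul_zero]
    have := congrArg Finsupp.degree (Finset.HasAntidiagonal.mem_antidiagonal.mp hx)
    rw [map_add] at this
    omega

theorem mem_lowDegIdeal {n : ℕ} {f : MvPowerSeries κ R} :
    f ∈ lowDegIdeal κ R n ↔ ∀ d : κ →₀ ℕ, d.degree < n → coeff d f = 0 := Iff.rfl

theorem lowDegIdeal_anti {m n : ℕ} (h : m ≤ n) : lowDegIdeal κ R n ≤ lowDegIdeal κ R m :=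
  fun _ hf d hd => hf d (by omega)

theorem mul_mem_lowDegIdeal {m n : ℕ} {f g : MvPowerSeries κ R} (hf : f ∈ lowDegIdeal κ R m)
    (hg : g ∈ lowDegIdeal κ R n) : f * g ∈ lowDegIdeal κ R (m + n) := by
  classical
  intro d hd
  rw [coeff_mul]
  refine Finset.sum_eq_zero fun x hx => ?_
  have := congrArg Finsupp.degree (Finset.HasAntidiagonal.mem_antidiagonal.mp hx)
  rw [map_add] at this
  by_cases h1 : x.1.degree < m
  · rw [hf _ h1, zero_mul]
  · rw [hg _ (by omega), mul_zero]

theorem smul_mem_lowDegIdeal {n : ℕ} {f : MvPowerSeries κ R} (hf : f ∈ lowDegIdeal κ R n) (r : R) :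
    r • f ∈ lowDegIdeal κ R n := fun d hd => by
  rw [coeff_smul, hf d hd, mul_zero]

theorem mem_lowDegIdeal_one {f : MvPowerSeries κ R} (hf : constantCoeff f = 0) :
    f ∈ lowDegIdeal κ R 1 := fun d hd => by
  obtain rfl : d = 0 := by
    rw [← Finsupp.degree_eq_zero_iff]
    omega
  exact hf

theorem eq_zero_of_forall_mem_lowDegIdeal {f : MvPowerSeries κ R}
    (hf : ∀ n, f ∈ lowDegIdeal κ R n) : f = 0 := by
  ext d
  exact hf (d.degree + 1) d (Nat.lt_succ_self _)

theorem matMul_mem_lowDegIdeal [Fintype ι] {n : ℕ} {f : ι → MvPowerSeries κ R}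
    (hf : ∀ k, f k ∈ lowDegIdeal κ R n) (A : Matrix ι ι R) (k : ι) :
    matMul A f k ∈ lowDegIdeal κ R n :=
  Ideal.sum_mem _ fun j _ => smul_mem_lowDegIdeal (hf j) _

/-- Monomials in two congruent tuples are congruent. -/
theorem prod_pow_sub_mem {S : Type*} [CommRing S] (I : Ideal S) {a b : κ → S}
    (h : ∀ j, a j - b j ∈ I) (d : κ →₀ ℕ) :
    (d.prod fun j m => a j ^ m) - (d.prod fun j m => b j ^ m) ∈ I := by
  rw [← Ideal.Quotient.eq, map_finsuppProd, map_finsuppProd]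
  refine Finsupp.prod_congr fun j _ => ?_
  rw [map_pow, map_pow, Ideal.Quotient.eq.mpr (h j)]

theorem prod_pow_single_add (a : κ → MvPowerSeries τ R) (j : κ) (e : κ →₀ ℕ) :
    ((Finsupp.single j 1 + e).prod fun j m => a j ^ m) = a j * e.prod fun j m => a j ^ m := by
  classical
  rw [Finsupp.prod_add_index (by simp) (by intros; rw [pow_add])]
  simp

/-- Criterion for the membership of a coefficient of `f(a) - f(b)` in an additive subgroup. -/
theorem coeff_subst_sub_mem [Finite κ] {a b : κ → MvPowerSeries τ R} (ha : ZeroConst a)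
    (hb : ZeroConst b) (f : MvPowerSeries κ R) (S : AddSubgroup R) (e : τ →₀ ℕ)
    (h : ∀ d : κ →₀ ℕ, coeff d f * coeff e ((d.prod fun j m => a j ^ m) -
      (d.prod fun j m => b j ^ m)) ∈ S) :
    coeff e (f.subst a - f.subst b) ∈ S := by
  rw [map_sub, coeff_subst ha.hasSubst, coeff_subst hb.hasSubst,
    ← finsum_sub_distrib (coeff_subst_finite ha.hasSubst f e)
      (coeff_subst_finite hb.hasSubst f e)]
  refine finsum_induction (· ∈ S) S.zero_mem (fun _ _ => S.add_mem) fun d => ?_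
  have := h d
  rwa [map_sub, mul_sub] at this

theorem subst_sub_mem_lowDegIdeal [Finite κ] {a b : κ → MvPowerSeries τ R} (ha : ZeroConst a)
    (hb : ZeroConst b) {n : ℕ} (h : ∀ j, a j - b j ∈ lowDegIdeal τ R n) (f : MvPowerSeries κ R) :
    f.subst a - f.subst b ∈ lowDegIdeal τ R n := by
  intro e he
  refine AddSubgroup.mem_bot.mp (coeff_subst_sub_mem ha hb f ⊥ e fun d => ?_)
  rw [AddSubgroup.mem_bot, prod_pow_sub_mem _ h d e he, mul_zero]

theorem exists_eq_single_add {d : κ →₀ ℕ} (hd : d ≠ 0) : ∃ j e, d = Finsupp.single j 1 + e := by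
  obtain ⟨j, hj⟩ := Finsupp.ne_iff.mp hd
  refine ⟨j, d - Finsupp.single j 1, (add_tsub_cancel_of_le ?_).symm⟩
  rw [Finsupp.single_le_iff]
  exact Nat.one_le_iff_ne_zero.mpr hj

theorem prod_pow_mem_lowDegIdeal_one {a : κ → MvPowerSeries τ R} (ha : ZeroConst a)
    {d : κ →₀ ℕ} (hd : d ≠ 0) : (d.prod fun j m => a j ^ m) ∈ lowDegIdeal τ R 1 := by
  obtain ⟨j, e, rfl⟩ := exists_eq_single_add hd
  rw [prod_pow_single_add]
  exact Ideal.mul_mem_right _ _ (mem_lowDegIdeal_one (ha j))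

/-- A monomial of degree at least two splits as a variable times a nonconstant monomial, and `aA -
bB = (a - b)A + (A - B)b`. Since `A` and `b` have no constant term, each product gains one degree;
this gain drives the successive approximations below. -/
theorem subst_sub_mem_lowDegIdeal_succ [Finite κ] {a b : κ → MvPowerSeries τ R} (ha : ZeroConst a)
    (hb : ZeroConst b) {n : ℕ} (h : ∀ j, a j - b j ∈ lowDegIdeal τ R n) {f : MvPowerSeries κ R}
    (hf : f ∈ lowDegIdeal κ R 2) :
    f.subst a - f.subst b ∈ lowDegIdeal τ R (n + 1) := by
  intro e he
  refine AddSubgroup.mem_bot.mp (coeff_subst_sub_mem ha hb f ⊥ e fun d => ?_)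
  rw [AddSubgroup.mem_bot]
  by_cases hd : d.degree < 2
  · rw [hf d hd, zero_mul]
  have hd0 : d ≠ 0 := by
    rintro rfl
    simp at hd
  obtain ⟨j, c, rfl⟩ := exists_eq_single_add hd0
  have hc : c ≠ 0 := by
    rintro rfl
    simp at hd
  rw [prod_pow_single_add, prod_pow_single_add]
  have key : a j * (c.prod fun j m => a j ^ m) - b j * (c.prod fun j m => b j ^ m) ∈
      lowDegIdeal τ R (n + 1) := by
    have : a j * (c.prod fun j m => a j ^ m) - b j * (c.prod fun j m => b j ^ m) =
        (a j - b j) * (c.prod fun j m => a j ^ m) +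
          ((c.prod fun j m => a j ^ m) - (c.prod fun j m => b j ^ m)) * b j := by ring
    rw [this]
    exact Ideal.add_mem _
      (mul_mem_lowDegIdeal (h j) (prod_pow_mem_lowDegIdeal_one ha hc))
      (mul_mem_lowDegIdeal (prod_pow_sub_mem _ h c) (mem_lowDegIdeal_one (hb j)))
  rw [key e he, mul_zero]

/-- A power series without constant term agrees with its linear part in degree less than two. -/
theorem sub_linear_mem_lowDegIdeal [Fintype ι] {L : ι → MvPowerSeries ι R} (hL : ZeroConst L)
    (k : ι) : L k - matMul (jacobian L) X k ∈ lowDegIdeal ι R 2 := by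
  classical
  intro d hd
  by_cases hd0 : d = 0
  · subst hd0
    have h1 := (zeroConst_X (ι := ι) (R := R)).matMul (jacobian L) k
    rw [map_sub, coeff_zero_eq_constantCoeff_apply, coeff_zero_eq_constantCoeff_apply, hL, h1,
      sub_zero]
  · obtain ⟨j, e, rfl⟩ := exists_eq_single_add hd0
    obtain rfl : e = 0 := by
      rw [← Finsupp.degree_eq_zero_iff]
      rw [map_add, Finsupp.degree_single] at hd
      omega
    simp [matMul, jacobian, coeff_X, Finsupp.single_left_inj]

/-- First order expansion of `L(a)` at `b`. -/
theorem comp_sub_comp_sub_mem [Fintype ι] {L : ι → MvPowerSeries ι R} (hL : ZeroConst L)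
    {a b : ι → MvPowerSeries τ R} (ha : ZeroConst a) (hb : ZeroConst b) {n : ℕ}
    (h : ∀ j, a j - b j ∈ lowDegIdeal τ R n) (k : ι) :
    (comp L a - comp L b - matMul (jacobian L) (a - b)) k ∈ lowDegIdeal τ R (n + 1) := by
  -- Only the nonlinear part of `L` is estimated; the linear part is substituted exactly.
  have h1 := subst_sub_mem_lowDegIdeal_succ ha hb h (sub_linear_mem_lowDegIdeal hL k)
  rw [subst_sub ha.hasSubst, subst_sub hb.hasSubst] at h1
  have h2 : ∀ {c : ι → MvPowerSeries τ R}, ZeroConst c →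
      (matMul (jacobian L) X k).subst c = matMul (jacobian L) c k := fun hc => by
    have := congrFun (matMul_comp (jacobian L) X hc) k
    rwa [X_comp hc] at this
  rw [h2 ha, h2 hb] at h1
  rw [matMul_sub]
  convert h1 using 1
  simp only [Pi.sub_apply, comp]
  ring

theorem comp_sub_comp_mem [Finite κ] (f : ι → MvPowerSeries κ R)
    {a b : κ → MvPowerSeries τ R} (ha : ZeroConst a) (hb : ZeroConst b) {n : ℕ}
    (h : ∀ j, a j - b j ∈ lowDegIdeal τ R n) (k : ι) :
    (comp f a - comp f b) k ∈ lowDegIdeal τ R n :=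
  subst_sub_mem_lowDegIdeal ha hb h (f k)

theorem matMul_inv_cancel [Fintype ι] [DecidableEq ι] {A : Matrix ι ι R} (hA : IsUnit A)
    (f : ι → MvPowerSeries κ R) : matMul A⁻¹ (matMul A f) = f := by
  rw [matMul_matMul, Matrix.nonsing_inv_mul _ ((Matrix.isUnit_iff_isUnit_det A).mp hA), one_matMul]

theorem matMul_cancel_inv [Fintype ι] [DecidableEq ι] {A : Matrix ι ι R} (hA : IsUnit A)
    (f : ι → MvPowerSeries κ R) : matMul A (matMul A⁻¹ f) = f := by
  rw [matMul_matMul, Matrix.mul_nonsing_inv _ ((Matrix.isUnit_iff_isUnit_det A).mp hA), one_matMul]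

theorem mem_lowDegIdeal_of_matMul [Fintype ι] [DecidableEq ι] {A : Matrix ι ι R} (hA : IsUnit A)
    {f : ι → MvPowerSeries κ R} {n : ℕ} (h : ∀ k, matMul A f k ∈ lowDegIdeal κ R n) (k : ι) :
    f k ∈ lowDegIdeal κ R n := by
  rw [← matMul_inv_cancel hA f]
  exact matMul_mem_lowDegIdeal h _ k

/-- Composition with a tuple of invertible Jacobian is injective. -/
theorem comp_injective [Fintype ι] [DecidableEq ι] {L : ι → MvPowerSeries ι R} (hL : ZeroConst L)
    (hJ : IsUnit (jacobian L)) {a b : ι → MvPowerSeries τ R} (ha : ZeroConst a) (hb : ZeroConst b)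
    (h : comp L a = comp L b) : a = b := by
  have key : ∀ n k, (a - b) k ∈ lowDegIdeal τ R n := by
    intro n
    induction n with
    | zero => exact fun k d hd => absurd hd (Nat.not_lt_zero _)
    | succ n ih =>
      refine mem_lowDegIdeal_of_matMul hJ fun k => ?_
      -- As `L(a) = L(b)`, the linear term `J(a - b)` equals the error term up to sign, which lies
      -- one degree deeper.
      have h1 := comp_sub_comp_sub_mem hL ha hb ih k
      rw [h, sub_self, zero_sub, Pi.neg_apply] at h1
      simpa using (lowDegIdeal τ R (n + 1)).neg_mem h1
  funext k
  exact sub_eq_zero.mp (eq_zero_of_forall_mem_lowDegIdeal fun n => key n k)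

/-- Successive approximations to the solution `m` of `L(m) = h`. -/
noncomputable def approxSolution [Fintype ι] [DecidableEq ι] (L : ι → MvPowerSeries ι R)
    (h : ι → MvPowerSeries τ R) : ℕ → ι → MvPowerSeries τ R
  | 0 => 0
  | n + 1 => approxSolution L h n + matMul (jacobian L)⁻¹ (h - comp L (approxSolution L h n))

theorem zeroConst_approxSolution [Fintype ι] [DecidableEq ι] {L : ι → MvPowerSeries ι R}
    {h : ι → MvPowerSeries τ R} (hL : ZeroConst L) (hh : ZeroConst h) (n : ℕ) :
    ZeroConst (approxSolution L h n) := by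
  induction n with
  | zero => exact zeroConst_zero
  | succ n ih => exact ih.add ((hh.sub (hL.comp ih)).matMul _)

/-- Newton iteration with the derivative frozen at `0`: the correction cancels the error to first
order, so the new error starts one degree later. -/
theorem sub_comp_approxSolution_mem [Fintype ι] [DecidableEq ι] {L : ι → MvPowerSeries ι R}
    {h : ι → MvPowerSeries τ R} (hL : ZeroConst L) (hJ : IsUnit (jacobian L)) (hh : ZeroConst h)
    (n : ℕ) (k : ι) : (h - comp L (approxSolution L h n)) k ∈ lowDegIdeal τ R (n + 1) := by
  induction n generalizing k with
  | zero =>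
    exact mem_lowDegIdeal_one ((hh.sub (hL.comp (zeroConst_approxSolution hL hh 0))) k)
  | succ n ih =>
    have h1 := comp_sub_comp_sub_mem hL (zeroConst_approxSolution hL hh (n + 1))
      (zeroConst_approxSolution hL hh n) (n := n + 1) (fun j => by
        rw [approxSolution, Pi.add_apply, add_sub_cancel_left]
        exact matMul_mem_lowDegIdeal ih _ j) k
    have h2 : approxSolution L h (n + 1) - approxSolution L h n =
        matMul (jacobian L)⁻¹ (h - comp L (approxSolution L h n)) := by
      rw [approxSolution, add_sub_cancel_left]
    rw [h2, matMul_cancel_inv hJ] at h1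
    convert (lowDegIdeal τ R (n + 1 + 1)).neg_mem h1 using 1
    simp only [Pi.sub_apply]
    ring

theorem approxSolution_sub_mem [Fintype ι] [DecidableEq ι] {L : ι → MvPowerSeries ι R}
    {h : ι → MvPowerSeries τ R} (hL : ZeroConst L) (hJ : IsUnit (jacobian L)) (hh : ZeroConst h)
    {m n : ℕ} (hmn : m ≤ n) (k : ι) :
    (approxSolution L h n - approxSolution L h m) k ∈ lowDegIdeal τ R (m + 1) := by
  induction n, hmn using Nat.le_induction with
  | base => simp
  | succ n hmn ih =>
    rw [approxSolution, add_sub_right_comm]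
    exact Ideal.add_mem _ ih (lowDegIdeal_anti (by omega)
      (matMul_mem_lowDegIdeal (sub_comp_approxSolution_mem hL hJ hh n) _ k))

/-- Formal inverse function theorem: `L(m) = h` is solvable if the Jacobian of `L` is invertible. -/
theorem exists_comp_eq [Fintype ι] [DecidableEq ι] {L : ι → MvPowerSeries ι R} (hL : ZeroConst L)
    (hJ : IsUnit (jacobian L)) {h : ι → MvPowerSeries τ R} (hh : ZeroConst h) :
    ∃ m : ι → MvPowerSeries τ R, ZeroConst m ∧ comp L m = h := by
  -- The coefficients of degree `n` no longer change from the `n`-th approximation on, so the limit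
  -- is read off diagonally.
  let m : ι → MvPowerSeries τ R := fun k d => coeff d (approxSolution L h d.degree k)
  have hm : ∀ k d, coeff d (m k) = coeff d (approxSolution L h d.degree k) := fun k d => rfl
  have hm0 : ZeroConst m := fun k => by
    rw [← coeff_zero_eq_constantCoeff_apply, hm, coeff_zero_eq_constantCoeff_apply]
    exact zeroConst_approxSolution hL hh _ k
  have hmn : ∀ n k, m k - approxSolution L h n k ∈ lowDegIdeal τ R (n + 1) := by
    intro n k d hd
    have h1 := approxSolution_sub_mem hL hJ hh (Nat.lt_succ_iff.mp hd) k d (Nat.lt_succ_self _)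
    rw [Pi.sub_apply, map_sub] at h1
    rw [map_sub, hm, ← neg_sub, h1, neg_zero]
  refine ⟨m, hm0, ?_⟩
  funext k
  refine sub_eq_zero.mp (eq_zero_of_forall_mem_lowDegIdeal fun n => ?_)
  have h1 := comp_sub_comp_mem L hm0 (zeroConst_approxSolution hL hh n) (hmn n) k
  have h2 := sub_comp_approxSolution_mem hL hJ hh n k
  refine lowDegIdeal_anti n.le_succ ?_
  convert (lowDegIdeal τ R (n + 1)).sub_mem h1 h2 using 1
  simp only [Pi.sub_apply]
  ring

/-- Solving `L(m) = X` gives a right inverse. It is also a left inverse, because `L(m(L)) = L =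
L(X)` and composition with `L` is injective. -/
theorem isCompInverse_compInv [Fintype ι] [DecidableEq ι] {L : ι → MvPowerSeries ι R} (hL : ZeroConst L)
    (hJ : IsUnit (jacobian L)) : IsCompInverse L (compInv L) := by
  have h : ∃ m, IsCompInverse L m := by
    obtain ⟨m, hm, hLm⟩ := exists_comp_eq hL hJ (zeroConst_X (ι := ι) (R := R))
    refine ⟨m, hL, hm, hLm, comp_injective hL hJ (hm.comp hL) zeroConst_X ?_⟩
    rw [← comp_comp L hm hL, hLm, X_comp hL, comp_X]
  rw [compInv, dif_pos h]
  exact h.choose_spec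

theorem eq_comp_compInv [Fintype ι] [DecidableEq ι] {L : ι → MvPowerSeries ι R} (hL : ZeroConst L)
    (hJ : IsUnit (jacobian L)) {m h : ι → MvPowerSeries τ R} (hm : ZeroConst m)
    (hmh : comp L m = h) : m = comp (compInv L) h := by
  rw [← hmh, ← comp_comp _ hL hm, (isCompInverse_compInv hL hJ).2.2.2, X_comp hm]

end Composition

/-! ### `p`-adic size of coefficients and descent to `ℤ_[p]`. -/

section IntegralSeries

variable (p : ℕ) [hp : Fact p.Prime] {ι κ τ : Type}

/-- The `p`-adic numbers of norm at most `p ^ z`. -/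
def padicBall (z : ℤ) : AddSubgroup ℚ_[p] where
  carrier := {x | ‖x‖ ≤ (p : ℝ) ^ z}
  add_mem' hx hy := (Padic.nonarchimedean _ _).trans (max_le hx hy)
  zero_mem' := by
    simp only [Set.mem_ofPred_eq, norm_zero]
    positivity
  neg_mem' hx := by simpa using hx

variable {p}

theorem mem_padicBall {z : ℤ} {x : ℚ_[p]} : x ∈ padicBall p z ↔ ‖x‖ ≤ (p : ℝ) ^ z := Iff.rfl

theorem one_lt_cast_prime : (1 : ℝ) < p := by exact_mod_cast hp.out.one_lt

theorem padicBall_mono {z w : ℤ} (h : z ≤ w) : padicBall p z ≤ padicBall p w := fun _ hx =>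
  le_trans (mem_padicBall.mp hx) (zpow_le_zpow_right₀ one_lt_cast_prime.le h)

theorem mul_mem_padicBall {z w : ℤ} {x y : ℚ_[p]} (hx : x ∈ padicBall p z)
    (hy : y ∈ padicBall p w) : x * y ∈ padicBall p (z + w) := by
  have h0 : (0 : ℝ) < p := by exact_mod_cast hp.out.pos
  rw [mem_padicBall, norm_mul, zpow_add₀ h0.ne']
  exact mul_le_mul hx hy (norm_nonneg _) (by positivity)

theorem coe_mem_padicBall (x : ℤ_[p]) : (x : ℚ_[p]) ∈ padicBall p 0 := by
  rw [mem_padicBall, zpow_zero]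
  exact x.norm_le_one

theorem coe_mem_padicBall_of_dvd {x : ℤ_[p]} {n : ℕ} (h : (p : ℤ_[p]) ^ n ∣ x) :
    (x : ℚ_[p]) ∈ padicBall p (-n) := by
  rw [mem_padicBall]
  exact (PadicInt.norm_le_pow_iff_mem_span_pow x n).mpr (Ideal.mem_span_singleton.mpr h)

theorem coeff_toQp (g : ι → MvPowerSeries κ ℤ_[p]) (k : ι) (d : κ →₀ ℕ) :
    coeff d (toQp p g k) = ((coeff d (g k) : ℤ_[p]) : ℚ_[p]) := coeff_map _ _ _

theorem toQp_injective : Function.Injective (toQp p : (ι → MvPowerSeries κ ℤ_[p]) → _) := by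
  intro f g h
  funext k
  ext d
  have := congrArg (coeff d) (congrFun h k)
  rw [coeff_toQp, coeff_toQp] at this
  exact Subtype.coe_injective this

theorem exists_toQp_eq {f : ι → MvPowerSeries κ ℚ_[p]}
    (h : ∀ k d, coeff d (f k) ∈ padicBall p 0) : ∃ g, toQp p g = f := by
  simp only [mem_padicBall, zpow_zero] at h
  let g : ι → MvPowerSeries κ ℤ_[p] := fun k d => ⟨coeff d (f k), h k d⟩
  refine ⟨g, ?_⟩
  funext k
  ext d
  rw [coeff_toQp]
  rfl

theorem zeroConst_toQp {g : ι → MvPowerSeries κ ℤ_[p]} :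
    ZeroConst (toQp p g) ↔ ZeroConst g := by
  refine forall_congr' fun k => ?_
  rw [← coeff_zero_eq_constantCoeff_apply, coeff_toQp, coeff_zero_eq_constantCoeff_apply]
  simp

theorem ZeroConst.toQp {g : ι → MvPowerSeries κ ℤ_[p]} (hg : ZeroConst g) :
    ZeroConst (toQp p g) := zeroConst_toQp.mpr hg

theorem toQp_comp [Finite κ] (f : ι → MvPowerSeries κ ℤ_[p]) {a : κ → MvPowerSeries τ ℤ_[p]}
    (ha : ZeroConst a) : toQp p (comp f a) = comp (toQp p f) (toQp p a) :=
  funext fun k => map_subst ha.hasSubst (f k)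

theorem toQp_X : toQp p (X : ι → MvPowerSeries ι ℤ_[p]) = X := funext fun k => map_X _ k

theorem toQp_variables (e : ι → κ) :
    toQp p (fun j => (X (e j) : MvPowerSeries κ ℤ_[p])) = fun j => X (e j) :=
  funext fun k => map_X _ (e k)

theorem toQp_zero : toQp p (0 : ι → MvPowerSeries κ ℤ_[p]) = 0 := funext fun _ => map_zero _

theorem toQp_add (f g : ι → MvPowerSeries κ ℤ_[p]) :
    toQp p (f + g) = toQp p f + toQp p g := funext fun _ => map_add _ _ _

theorem toQp_sub (f g : ι → MvPowerSeries κ ℤ_[p]) :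
    toQp p (f - g) = toQp p f - toQp p g := funext fun _ => map_sub _ _ _

theorem toQp_smul (a : ℤ_[p]) (f : ι → MvPowerSeries κ ℤ_[p]) :
    toQp p (a • f) = (a : ℚ_[p]) • toQp p f := by
  funext k
  ext d
  rw [coeff_toQp, Pi.smul_apply, Pi.smul_apply, coeff_smul, coeff_smul, coeff_toQp]
  exact PadicInt.coe_mul _ _

theorem toQp_sumElim (f : ι → MvPowerSeries τ ℤ_[p]) (g : κ → MvPowerSeries τ ℤ_[p]) :
    toQp p (Sum.elim f g) = Sum.elim (toQp p f) (toQp p g) := by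
  funext k
  rcases k with k | k <;> rfl

theorem toQp_matMul [Fintype ι] (A : Matrix ι ι ℤ_[p]) (f : ι → MvPowerSeries κ ℤ_[p]) :
    toQp p (matMul A f) = matMul (A.map PadicInt.Coe.ringHom) (toQp p f) := by
  funext k
  ext d
  rw [coeff_toQp]
  simp only [matMul, map_sum, coeff_smul, coeff_toQp, Matrix.map_apply]
  exact map_sum PadicInt.Coe.ringHom _ _

theorem toQp_mem_lowDegIdeal {g : ι → MvPowerSeries κ ℤ_[p]} {n : ℕ} {k : ι} :
    toQp p g k ∈ lowDegIdeal κ ℚ_[p] n ↔ g k ∈ lowDegIdeal κ ℤ_[p] n := by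
  simp [mem_lowDegIdeal, coeff_toQp]

theorem jacobian_toQp (g : ι → MvPowerSeries κ ℤ_[p]) :
    jacobian (toQp p g) = (jacobian g).map PadicInt.Coe.ringHom := by
  ext k j
  exact coeff_toQp _ _ _

end IntegralSeries

/-! ### The substitution `X ↦ X ^ (p ^ i)` and its congruence with powers modulo `p`. -/

section FrobeniusExpansion

variable {p : ℕ} [hp : Fact p.Prime] {ι κ τ : Type}

theorem frobExpand_add (i : ℕ) (f g : ι → MvPowerSeries κ ℚ_[p]) :
    frobExpand p i (f + g) = frobExpand p i f + frobExpand p i g :=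
  funext fun _ => map_add _ _ _

theorem frobExpand_sub (i : ℕ) (f g : ι → MvPowerSeries κ ℚ_[p]) :
    frobExpand p i (f - g) = frobExpand p i f - frobExpand p i g :=
  funext fun _ => map_sub _ _ _

theorem frobExpand_smul (i : ℕ) (a : ℚ_[p]) (f : ι → MvPowerSeries κ ℚ_[p]) :
    frobExpand p i (a • f) = a • frobExpand p i f :=
  funext fun k => map_smul (expand (p ^ i) (pow_ne_zero i hp.out.ne_zero)) a (f k)

/-- The substitution strictly raises the degree of each nonconstant monomial, and `0 < n` excludes a
constant term. -/
theorem frobExpand_mem_lowDegIdeal [Fintype ι] {f : ι → MvPowerSeries κ ℚ_[p]} {n : ℕ}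
    (hn : 0 < n) (hf : ∀ k, f k ∈ lowDegIdeal κ ℚ_[p] n) {i : ℕ} (hi : i ≠ 0) (k : ι) :
    frobExpand p i f k ∈ lowDegIdeal κ ℚ_[p] (n + 1) := by
  classical
  intro d hd
  rw [coeff_frobExpand]
  split_ifs
  · by_cases h0 : d = 0
    · subst h0
      refine hf k _ ?_
      simpa [divExp] using hn
    · refine hf k _ ?_
      have := degree_divExp_lt h0 (Nat.one_lt_pow hi hp.out.one_lt)
      omega
  · rfl

theorem frobExpand_comp [Finite κ] (i : ℕ) (f : ι → MvPowerSeries κ ℚ_[p])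
    {a : κ → MvPowerSeries τ ℚ_[p]} (ha : ZeroConst a) :
    frobExpand p i (comp f a) = comp f (frobExpand p i a) :=
  funext fun _ => expand_subst _ _ ha.hasSubst

/-- To be contrasted with `frobExpand_comp`: expanding before substituting produces the powers `a j
^ p ^ i`, expanding afterwards produces `a j (X ^ (p ^ i))`. The gap between the two is the whole
obstruction to `L(a)` having the type of `L`. -/
theorem comp_frobExpand [Finite κ] (i : ℕ) (f : ι → MvPowerSeries κ ℚ_[p])
    {a : κ → MvPowerSeries τ ℚ_[p]} (ha : ZeroConst a) :
    comp (frobExpand p i f) a = comp f (fun j => a j ^ p ^ i) := by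
  funext k
  have h0 : p ^ i ≠ 0 := pow_ne_zero i hp.out.ne_zero
  rw [comp, frobExpand, expand, substAlgHom_apply,
    subst_comp_subst_apply (HasSubst.X_pow h0) ha.hasSubst]
  simp only [subst_pow ha.hasSubst, subst_X ha.hasSubst]
  rfl

/-- A power series over `ℤ_[p]` all of whose coefficients are divisible by `p` is divisible by
`p`. -/
theorem natCast_dvd_of_map_toZMod_eq_zero {f : MvPowerSeries κ ℤ_[p]}
    (h : f.map PadicInt.toZMod = 0) : (p : MvPowerSeries κ ℤ_[p]) ∣ f := by
  have h1 : ∀ d, (p : ℤ_[p]) ∣ coeff d f := fun d => by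
    have h2 : PadicInt.toZMod (coeff d f) = 0 := by
      rw [← coeff_map, h, map_zero]
    have h3 : coeff d f ∈ RingHom.ker (PadicInt.toZMod (p := p)) := h2
    rwa [PadicInt.ker_toZMod, PadicInt.maximalIdeal_eq_span_p, Ideal.mem_span_singleton] at h3
  choose c hc using h1
  let q : MvPowerSeries κ ℤ_[p] := c
  refine ⟨q, ?_⟩
  ext d
  rw [hc d, show (p : MvPowerSeries κ ℤ_[p]) = C (p : ℤ_[p]) by simp, coeff_C_mul]
  rfl

/-- Over `ZMod p` the iterated Frobenius is additive and fixes the coefficients, so the `p ^ i`-th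
power of a series is its expansion. -/
theorem natCast_dvd_pow_sub_expand (f : MvPowerSeries κ ℤ_[p]) (i : ℕ) :
    (p : MvPowerSeries κ ℤ_[p]) ∣
      f ^ p ^ i - expand (p ^ i) (pow_ne_zero i hp.out.ne_zero) f := by
  refine natCast_dvd_of_map_toZMod_eq_zero ?_
  have h : iterateFrobenius (ZMod p) p i = RingHom.id _ := by
    ext x
    simp [iterateFrobenius_def]
  rw [map_sub, map_pow, map_expand, ← map_iterateFrobenius_expand p hp.out.ne_zero, h]
  simp [map_id]

end FrobeniusExpansion

/-! ### Series of a given type and the functional equation lemma. -/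

section TypedSeries

variable {p : ℕ} [hp : Fact p.Prime] {ι κ τ : Type} [Fintype ι]

/-- The sum `∑_{1 ≤ i ≤ N} s_i f(X ^ (p ^ i))`. -/
noncomputable def frobSum (N : ℕ) (s : ℕ → Matrix ι ι ℚ_[p]) (f : ι → MvPowerSeries κ ℚ_[p]) :
    ι → MvPowerSeries κ ℚ_[p] :=
  ∑ i ∈ Finset.Icc 1 N, matMul (s i) (frobExpand p i f)

theorem frobSum_add (N : ℕ) (s : ℕ → Matrix ι ι ℚ_[p]) (f g : ι → MvPowerSeries κ ℚ_[p]) :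
    frobSum N s (f + g) = frobSum N s f + frobSum N s g := by
  simp only [frobSum, frobExpand_add, matMul_add, Finset.sum_add_distrib]

theorem frobSum_sub (N : ℕ) (s : ℕ → Matrix ι ι ℚ_[p]) (f g : ι → MvPowerSeries κ ℚ_[p]) :
    frobSum N s (f - g) = frobSum N s f - frobSum N s g := by
  simp only [frobSum, frobExpand_sub, matMul_sub, Finset.sum_sub_distrib]

theorem frobSum_smul (N : ℕ) (s : ℕ → Matrix ι ι ℚ_[p]) (a : ℚ_[p])
    (f : ι → MvPowerSeries κ ℚ_[p]) : frobSum N s (a • f) = a • frobSum N s f := by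
  simp only [frobSum, frobExpand_smul, matMul_smul, Finset.smul_sum]

theorem frobSum_mem_lowDegIdeal {N : ℕ} {s : ℕ → Matrix ι ι ℚ_[p]}
    {f : ι → MvPowerSeries κ ℚ_[p]} {n : ℕ} (hn : 0 < n)
    (hf : ∀ k, f k ∈ lowDegIdeal κ ℚ_[p] n) (k : ι) :
    frobSum N s f k ∈ lowDegIdeal κ ℚ_[p] (n + 1) := by
  rw [frobSum, Finset.sum_apply]
  refine Ideal.sum_mem _ fun i hi => matMul_mem_lowDegIdeal (fun j => ?_) _ _
  exact frobExpand_mem_lowDegIdeal hn hf (by have := Finset.mem_Icc.mp hi; omega) j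

/-- `f` has no constant term and satisfies the functional equation with data `s` (cut off at `N`)
and `e`. -/
structure HasTypeWith (N : ℕ) (s : ℕ → Matrix ι ι ℚ_[p]) (e : ι → MvPowerSeries κ ℤ_[p])
    (f : ι → MvPowerSeries κ ℚ_[p]) : Prop where
  zeroConst : ZeroConst f
  eqn : f = toQp p e + frobSum N s f

/-- `f` satisfies some functional equation with data `s`. -/
def HasType (N : ℕ) (s : ℕ → Matrix ι ι ℚ_[p]) (f : ι → MvPowerSeries κ ℚ_[p]) : Prop :=
  ∃ e, HasTypeWith N s e f

variable {N : ℕ} {s : ℕ → Matrix ι ι ℚ_[p]}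

theorem HasType.add {f g : ι → MvPowerSeries κ ℚ_[p]} (hf : HasType N s f) (hg : HasType N s g) :
    HasType N s (f + g) := by
  obtain ⟨a, ha, ha'⟩ := hf
  obtain ⟨b, hb, hb'⟩ := hg
  refine ⟨a + b, ha.add hb, ?_⟩
  conv_lhs => rw [ha', hb']
  rw [frobSum_add, toQp_add]
  abel

theorem HasTypeWith.sub {f g : ι → MvPowerSeries κ ℚ_[p]} {a b : ι → MvPowerSeries κ ℤ_[p]}
    (hf : HasTypeWith N s a f) (hg : HasTypeWith N s b g) :
    HasTypeWith N s (a - b) (f - g) := by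
  refine ⟨hf.zeroConst.sub hg.zeroConst, ?_⟩
  conv_lhs => rw [hf.eqn, hg.eqn]
  rw [frobSum_sub, toQp_sub]
  abel

theorem HasType.smul {f : ι → MvPowerSeries κ ℚ_[p]} (hf : HasType N s f) (a : ℤ_[p]) :
    HasType N s ((a : ℚ_[p]) • f) := by
  obtain ⟨e, he, he'⟩ := hf
  refine ⟨a • e, he.smul _, ?_⟩
  conv_lhs => rw [he']
  rw [frobSum_smul, toQp_smul, smul_add]

/-- The Frobenius terms of a series of order `n` start in degree `n + 1`, so its part of degree `n`
is that of `e`, hence integral. -/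
theorem HasTypeWith.sub_mem_lowDegIdeal {f : ι → MvPowerSeries κ ℚ_[p]}
    {e : ι → MvPowerSeries κ ℤ_[p]} (hf : HasTypeWith N s e f) {n : ℕ} (hn : 0 < n)
    (h : ∀ k, f k ∈ lowDegIdeal κ ℚ_[p] n) (k : ι) :
    (f - toQp p e) k ∈ lowDegIdeal κ ℚ_[p] (n + 1) := by
  have h1 : f - toQp p e = frobSum N s f := sub_eq_iff_eq_add'.mpr hf.eqn
  rw [h1]
  exact frobSum_mem_lowDegIdeal hn h k

theorem HasTypeWith.zeroConst_left {f : ι → MvPowerSeries κ ℚ_[p]}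
    {e : ι → MvPowerSeries κ ℤ_[p]} (hf : HasTypeWith N s e f) : ZeroConst e := by
  refine zeroConst_toQp.mp fun k => ?_
  have h := hf.sub_mem_lowDegIdeal one_pos (fun k => mem_lowDegIdeal_one (hf.zeroConst k)) k 0
    (by simp)
  rw [coeff_zero_eq_constantCoeff_apply, Pi.sub_apply, map_sub, hf.zeroConst k, zero_sub,
    neg_eq_zero] at h
  exact h

theorem HasTypeWith.jacobian_eq {L : ι → MvPowerSeries κ ℚ_[p]}
    {g : ι → MvPowerSeries κ ℤ_[p]} (hL : HasTypeWith N s g L) :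
    jacobian L = (jacobian g).map PadicInt.Coe.ringHom := by
  rw [← jacobian_toQp]
  ext k j
  have h := hL.sub_mem_lowDegIdeal one_pos (fun k => mem_lowDegIdeal_one (hL.zeroConst k)) k
    (Finsupp.single j 1) (by simp)
  rw [Pi.sub_apply, map_sub] at h
  exact sub_eq_zero.mp h

/-- The denominators of a typed series: the coefficient of `X ^ d` has denominator at most the
largest power of `p` dividing `d`. -/
theorem HasTypeWith.coeff_mem_padicBall {L : ι → MvPowerSeries κ ℚ_[p]}
    {g : ι → MvPowerSeries κ ℤ_[p]} (hL : HasTypeWith N s g L)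
    (hs : ∀ i k j, s i k j ∈ padicBall p 1) (d : κ →₀ ℕ) (t : ℕ)
    (ht : ¬ ∀ j, p ^ (t + 1) ∣ d j) (k : ι) : coeff d (L k) ∈ padicBall p t := by
  classical
  have main : ∀ n (d : κ →₀ ℕ), d.degree = n → ∀ t : ℕ, (¬ ∀ j, p ^ (t + 1) ∣ d j) →
      ∀ k, coeff d (L k) ∈ padicBall p t := by
    intro n
    induction n using Nat.strong_induction_on with
    | _ n ih =>
    intro d hdn t ht k
    have hd : d ≠ 0 := by
      rintro rfl
      exact ht fun j => dvd_zero _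
    rw [hL.eqn, Pi.add_apply, map_add, coeff_toQp]
    refine add_mem (padicBall_mono (by positivity) (coe_mem_padicBall _)) ?_
    rw [frobSum, Finset.sum_apply, map_sum]
    refine sum_mem fun i hi => ?_
    rw [matMul, map_sum]
    refine sum_mem fun j _ => ?_
    rw [coeff_smul, coeff_frobExpand]
    split_ifs with hdiv
    · have hi1 := (Finset.mem_Icc.mp hi).1
      have hit : i ≤ t := by
        by_contra hlt
        exact ht fun j => (pow_dvd_pow p (by omega)).trans (hdiv j)
      have hlt := degree_divExp_lt hd (Nat.one_lt_pow (Nat.ne_of_gt hi1) hp.out.one_lt)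
      have h1 := ih _ (hdn ▸ hlt) _ rfl (t - i) (fun hall => ht fun j => by
        have h2 : divExp d (p ^ i) j = d j / p ^ i := rfl
        have h3 := hall j
        rw [h2, Nat.dvd_div_iff_mul_dvd (hdiv j), ← pow_add] at h3
        rwa [show t + 1 = i + (t - i + 1) by omega]) j
      -- The factor `s i` costs one power of `p`, while dividing the exponent by `p ^ i` saves `i ≥
      -- 1` of them: `1 + (t - i) ≤ t`.
      exact padicBall_mono (by omega) (mul_mem_padicBall (hs i k j) h1)
    · rw [mul_zero]
      exact zero_mem _
  exact main _ d rfl t ht k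

theorem exists_pow_dvd_not_pow_succ_dvd {d : κ →₀ ℕ} (hd : d ≠ 0) :
    ∃ (t : ℕ) (c : κ →₀ ℕ), d = p ^ t • c ∧ ¬ ∀ j, p ^ (t + 1) ∣ d j := by
  classical
  have hex : ∃ n, ¬ ∀ j, p ^ n ∣ d j := by
    obtain ⟨j, hj⟩ := Finsupp.ne_iff.mp hd
    exact ⟨d j, fun h => absurd (Nat.le_of_dvd (Nat.pos_of_ne_zero hj) (h j))
      (not_le.mpr (Nat.lt_pow_self hp.out.one_lt))⟩
  obtain ⟨t, ht⟩ : ∃ t, Nat.find hex = t + 1 := Nat.exists_eq_succ_of_ne_zero fun h0 =>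
    Nat.find_spec hex (by rw [h0]; simp)
  have hdiv : ∀ j, p ^ t ∣ d j := not_not.mp (Nat.find_min hex (by omega : t < Nat.find hex))
  refine ⟨t, divExp d (p ^ t), ?_, ht ▸ Nat.find_spec hex⟩
  ext j
  simp [divExp, Nat.mul_div_cancel' (hdiv j)]

theorem prod_pow_smul {S : Type*} [CommRing S] (a : κ → S) (n : ℕ) (c : κ →₀ ℕ) :
    ((n • c).prod fun j m => a j ^ m) = (c.prod fun j m => a j ^ m) ^ n := by
  rw [Finsupp.prod_of_support_subset _ Finsupp.support_smul _ (by simp), Finsupp.prod,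
    ← Finset.prod_pow]
  exact Finset.prod_congr rfl fun j _ => by simp [mul_comm n, pow_mul]

/-- A typed series maps tuples congruent modulo `p` to tuples congruent modulo `p`. -/
theorem HasTypeWith.coeff_comp_sub_comp_mem [Finite κ] {L : ι → MvPowerSeries κ ℚ_[p]}
    {g : ι → MvPowerSeries κ ℤ_[p]} (hL : HasTypeWith N s g L)
    (hs : ∀ i k j, s i k j ∈ padicBall p 1) {a b : κ → MvPowerSeries τ ℤ_[p]}
    (ha : ZeroConst a) (hb : ZeroConst b)
    (h : ∀ j, (p : MvPowerSeries τ ℤ_[p]) ∣ a j - b j) (k : ι) (e : τ →₀ ℕ) :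
    coeff e ((comp L (toQp p a) - comp L (toQp p b)) k) ∈ padicBall p (-1) := by
  refine coeff_subst_sub_mem ha.toQp hb.toQp (L k) _ e fun d => ?_
  by_cases hd : d = 0
  · simp [hd]
  -- The monomials of exponent `p ^ t • c` are `p ^ t`-th powers of elements congruent modulo `p`,
  -- hence congruent modulo `p ^ (t + 1)`. The denominator of the coefficient, at most `p ^ t`,
  -- leaves one factor `p`.
  obtain ⟨t, c, rfl, ht⟩ := exists_pow_dvd_not_pow_succ_dvd (p := p) hd
  have h1 : (p : MvPowerSeries τ ℤ_[p]) ∣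
      (c.prod fun j m => a j ^ m) - (c.prod fun j m => b j ^ m) :=
    Ideal.mem_span_singleton.mp
      (prod_pow_sub_mem _ (fun j => Ideal.mem_span_singleton.mpr (h j)) c)
  obtain ⟨q, hq⟩ := dvd_sub_pow_of_dvd_sub h1 t
  rw [← prod_pow_smul, ← prod_pow_smul] at hq
  have h2 : (((p ^ t • c).prod fun j m => toQp p a j ^ m) -
      ((p ^ t • c).prod fun j m => toQp p b j ^ m)) =
      (((p ^ t • c).prod fun j m => a j ^ m) -
      ((p ^ t • c).prod fun j m => b j ^ m)).map PadicInt.Coe.ringHom := by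
    rw [map_sub, map_finsuppProd, map_finsuppProd]
    simp only [map_pow]
    rfl
  rw [h2, hq, coeff_map]
  have h3 : (p : ℤ_[p]) ^ (t + 1) ∣ coeff e ((p : MvPowerSeries τ ℤ_[p]) ^ (t + 1) * q) := by
    rw [show (p : MvPowerSeries τ ℤ_[p]) ^ (t + 1) = C ((p : ℤ_[p]) ^ (t + 1)) by simp,
      coeff_C_mul]
    exact dvd_mul_right _ _
  refine padicBall_mono ?_ (mul_mem_padicBall (hL.coeff_mem_padicBall hs _ t ht k)
    (coe_mem_padicBall_of_dvd h3))
  push_cast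
  omega

/-- Substituting an integral tuple in a typed series yields a series of the same type. -/
theorem HasTypeWith.comp_toQp [Finite κ] {L : ι → MvPowerSeries κ ℚ_[p]}
    {g : ι → MvPowerSeries κ ℤ_[p]} (hL : HasTypeWith N s g L)
    (hs : ∀ i k j, s i k j ∈ padicBall p 1) {m : κ → MvPowerSeries τ ℤ_[p]} (hm : ZeroConst m) :
    HasType N s (comp L (toQp p m)) := by
  have h1 : comp L (toQp p m) = toQp p (comp g m) + ∑ i ∈ Finset.Icc 1 N,
      matMul (s i) (comp L (fun j => toQp p m j ^ p ^ i)) := by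
    conv_lhs => rw [hL.eqn, comp_add _ _ hm.toQp, ← toQp_comp _ hm]
    congr 1
    have h2 : comp (frobSum N s L) (toQp p m) =
        ∑ i ∈ Finset.Icc 1 N, comp (matMul (s i) (frobExpand p i L)) (toQp p m) := by
      funext k
      simp only [frobSum, comp, Finset.sum_apply, ← substAlgHom_apply hm.toQp.hasSubst, map_sum]
    rw [h2]
    exact Finset.sum_congr rfl fun i _ => by
      rw [matMul_comp _ _ hm.toQp, comp_frobExpand _ _ hm.toQp]
  have h3 : ∀ k d, coeff d ((comp L (toQp p m) - frobSum N s (comp L (toQp p m))) k) ∈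
      padicBall p 0 := by
    intro k d
    have h4 : comp L (toQp p m) - frobSum N s (comp L (toQp p m)) = toQp p (comp g m) +
        ∑ i ∈ Finset.Icc 1 N, matMul (s i) (comp L (fun j => toQp p m j ^ p ^ i) -
          comp L (frobExpand p i (toQp p m))) := by
      rw [sub_eq_iff_eq_add]
      conv_lhs => rw [h1]
      simp only [frobSum, frobExpand_comp _ _ hm.toQp, matMul_sub, Finset.sum_sub_distrib]
      abel
    rw [h4, Pi.add_apply, map_add, coeff_toQp, Finset.sum_apply, map_sum]
    refine add_mem (coe_mem_padicBall _) (sum_mem fun i hi => ?_)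
    rw [matMul, map_sum]
    refine sum_mem fun j _ => ?_
    rw [coeff_smul]
    have h5 : (fun j => toQp p m j ^ p ^ i) = toQp p fun j => m j ^ p ^ i := by
      funext j
      exact (map_pow _ _ _).symm
    have h6 : frobExpand p i (toQp p m) =
        toQp p fun j => expand (p ^ i) (pow_ne_zero i hp.out.ne_zero) (m j) := by
      funext j
      exact (map_expand _ _ _ _).symm
    rw [h5, h6]
    -- The factor `p` gained from the congruence cancels the denominator of `s i`.
    have h7 := mul_mem_padicBall (hs i k j) (hL.coeff_comp_sub_comp_mem hs
      (a := fun j => m j ^ p ^ i)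
      (b := fun j => expand (p ^ i) (pow_ne_zero i hp.out.ne_zero) (m j))
      (fun j => by rw [map_pow, hm j, zero_pow (pow_ne_zero i hp.out.ne_zero)])
      (fun j => by rw [constantCoeff_expand, hm j])
      (fun j => natCast_dvd_pow_sub_expand (m j) i) j d)
    simpa using h7
  obtain ⟨e, he⟩ := exists_toQp_eq h3
  exact ⟨e, hL.zeroConst.comp hm.toQp, by rw [he, sub_add_cancel]⟩

/-- The functional equation lemma: if the Jacobian of `g` is invertible over `ℤ_[p]`, then
`L_g⁻¹ ∘ f` is integral for every `f` of the same type. -/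
theorem HasTypeWith.exists_comp_toQp_eq [DecidableEq ι] {L : ι → MvPowerSeries ι ℚ_[p]}
    {g : ι → MvPowerSeries ι ℤ_[p]} (hL : HasTypeWith N s g L) (hg : IsUnit (jacobian g))
    (hs : ∀ i k j, s i k j ∈ padicBall p 1) {f : ι → MvPowerSeries τ ℚ_[p]}
    (hf : HasType N s f) : ∃ m, ZeroConst m ∧ comp L (toQp p m) = f := by
  have hJ : IsUnit (jacobian L) := by
    rw [hL.jacobian_eq]
    exact hg.map (PadicInt.Coe.ringHom.mapMatrix)
  obtain ⟨e, he⟩ := hf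
  obtain ⟨M, hM, hLM⟩ := exists_comp_eq hL.zeroConst hJ he.zeroConst
  -- The solution `M` over `ℚ_[p]` is approximated by integral tuples up to any degree.
  have key : ∀ n, ∃ m : ι → MvPowerSeries τ ℤ_[p], ZeroConst m ∧
      ∀ k, (M - toQp p m) k ∈ lowDegIdeal τ ℚ_[p] (n + 1) := by
    intro n
    induction n with
    | zero =>
      refine ⟨0, zeroConst_zero, fun k => mem_lowDegIdeal_one ?_⟩
      rw [toQp_zero, sub_zero, hM k]
    | succ n ih =>
      obtain ⟨m, hm, hMm⟩ := ih
      obtain ⟨e', he'⟩ := hL.comp_toQp hs hm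
      -- The error `f - L(m)` is again typed, now with order at least `n + 1`. Modulo degree `n + 2`
      -- it equals both the integral tuple `e - e'` and `J(M - m)`, which dictates the integral
      -- correction `J⁻¹(e - e')`.
      have hd := he.sub he'
      have h1 : ∀ k, (f - comp L (toQp p m)) k ∈ lowDegIdeal τ ℚ_[p] (n + 1) := by
        rw [← hLM]
        exact comp_sub_comp_mem L hM hm.toQp hMm
      have h2 := hd.sub_mem_lowDegIdeal n.succ_pos h1
      have h3 := comp_sub_comp_sub_mem hL.zeroConst hM hm.toQp hMm
      rw [hLM] at h3
      refine ⟨m + matMul (jacobian g)⁻¹ (e - e'), hm.add (hd.zeroConst_left.matMul _),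
        mem_lowDegIdeal_of_matMul hJ fun k => ?_⟩
      have h4 : matMul (jacobian L) (M - toQp p (m + matMul (jacobian g)⁻¹ (e - e'))) =
          (f - comp L (toQp p m) - toQp p (e - e')) -
            (f - comp L (toQp p m) - matMul (jacobian L) (M - toQp p m)) := by
        rw [toQp_add, ← sub_sub, matMul_sub, hL.jacobian_eq, ← toQp_matMul,
          matMul_cancel_inv hg]
        abel
      rw [h4]
      exact Ideal.sub_mem _ (h2 k) (h3 k)
  obtain ⟨m, hm⟩ : ∃ m, toQp p m = M := exists_toQp_eq fun k d => by
    obtain ⟨m, -, h⟩ := key d.degree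
    have := h k d (Nat.lt_succ_self _)
    rw [Pi.sub_apply, map_sub, sub_eq_zero] at this
    rw [this, coeff_toQp]
    exact coe_mem_padicBall _
  exact ⟨m, zeroConst_toQp.mp (hm ▸ hM), hm ▸ hLM⟩

end TypedSeries

/-! ### Integral formal groups, homomorphisms and multiplications from typed logarithms. -/

section Logarithm

variable {p : ℕ} [hp : Fact p.Prime] {ι κ τ : Type} [Fintype ι] [DecidableEq ι]

/-- `L` satisfies a functional equation with data `s`, where `p s_i` is integral, and its Jacobian
is invertible over `ℤ_[p]`. -/
structure IsTypedLog (N : ℕ) (s : ℕ → Matrix ι ι ℚ_[p]) (L : ι → MvPowerSeries ι ℚ_[p]) :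
    Prop where
  mem_padicBall : ∀ i k j, s i k j ∈ padicBall p 1
  hasTypeWith : ∃ g, HasTypeWith N s g L ∧ IsUnit (jacobian g)

/-- The series `L(a)` for an integral tuple `a`. -/
noncomputable def logOf (L : ι → MvPowerSeries κ ℚ_[p]) (a : κ → MvPowerSeries τ ℤ_[p]) :
    ι → MvPowerSeries τ ℚ_[p] := comp L (toQp p a)

variable {N : ℕ} {s : ℕ → Matrix ι ι ℚ_[p]} {L L' : ι → MvPowerSeries ι ℚ_[p]}

omit [Fintype ι] [DecidableEq ι] in
theorem logOf_comp [Finite ι] [Finite κ] (L : ι → MvPowerSeries ι ℚ_[p])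
    {a : ι → MvPowerSeries κ ℤ_[p]}
    {b : κ → MvPowerSeries τ ℤ_[p]} (ha : ZeroConst a) (hb : ZeroConst b) :
    logOf L (comp a b) = comp (logOf L a) (toQp p b) := by
  rw [logOf, logOf, toQp_comp a hb, comp_comp L ha.toQp hb.toQp]

omit [Fintype ι] [DecidableEq ι] in
theorem logOf_X (L : ι → MvPowerSeries ι ℚ_[p]) :
    logOf L (X : ι → MvPowerSeries ι ℤ_[p]) = L := by
  rw [logOf, toQp_X, comp_X]

namespace IsTypedLog

theorem zeroConst (hL : IsTypedLog N s L) : ZeroConst L :=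
  hL.hasTypeWith.choose_spec.1.zeroConst

theorem isUnit_jacobian (hL : IsTypedLog N s L) : IsUnit (jacobian L) := by
  obtain ⟨g, hg, hJ⟩ := hL.hasTypeWith
  rw [hg.jacobian_eq]
  exact hJ.map (PadicInt.Coe.ringHom.mapMatrix)

theorem hasType (hL : IsTypedLog N s L) : HasType N s L :=
  ⟨_, hL.hasTypeWith.choose_spec.1⟩

theorem hasType_logOf (hL : IsTypedLog N s L) {m : ι → MvPowerSeries τ ℤ_[p]}
    (hm : ZeroConst m) : HasType N s (logOf L m) := by
  obtain ⟨g, hg, -⟩ := hL.hasTypeWith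
  exact hg.comp_toQp hL.mem_padicBall hm

theorem exists_logOf_eq (hL : IsTypedLog N s L) {f : ι → MvPowerSeries τ ℚ_[p]}
    (hf : HasType N s f) : ∃ m, ZeroConst m ∧ logOf L m = f := by
  obtain ⟨g, hg, hJ⟩ := hL.hasTypeWith
  exact hg.exists_comp_toQp_eq hJ hL.mem_padicBall hf

/-- The device behind the identities of this section: integral tuples are compared through their
logarithms. -/
theorem logOf_injective (hL : IsTypedLog N s L) {a b : ι → MvPowerSeries τ ℤ_[p]}
    (ha : ZeroConst a) (hb : ZeroConst b) (h : logOf L a = logOf L b) : a = b :=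
  toQp_injective (comp_injective hL.zeroConst hL.isUnit_jacobian ha.toQp hb.toQp h)

theorem logOf_zero (hL : IsTypedLog N s L) :
    logOf L (0 : ι → MvPowerSeries τ ℤ_[p]) = 0 := by
  rw [logOf, toQp_zero, comp_zero hL.zeroConst]

theorem isCompInverse (hL : IsTypedLog N s L) : IsCompInverse L (compInv L) :=
  isCompInverse_compInv hL.zeroConst hL.isUnit_jacobian

theorem toQp_eq_comp_compInv (hL : IsTypedLog N s L) {m : ι → MvPowerSeries τ ℤ_[p]}
    (hm : ZeroConst m) {h : ι → MvPowerSeries τ ℚ_[p]} (hmh : logOf L m = h) :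
    toQp p m = comp (compInv L) h :=
  eq_comp_compInv hL.zeroConst hL.isUnit_jacobian hm.toQp hmh

end IsTypedLog

/-- `F` is the integral formal group with logarithm `L`, that is `L(F) = L(X) + L(Y)`. -/
structure HasLog (F : ι → MvPowerSeries (ι ⊕ ι) ℤ_[p]) (L : ι → MvPowerSeries ι ℚ_[p]) :
    Prop where
  zeroConst : ZeroConst F
  logOf_eq : logOf L F =
    (comp L fun j => X (Sum.inl j)) + comp L fun j => X (Sum.inr j)

omit [Fintype ι] [DecidableEq ι] in
theorem HasLog.logOf_comp [Finite ι] {F : ι → MvPowerSeries (ι ⊕ ι) ℤ_[p]} (hF : HasLog F L)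
    {a b : ι → MvPowerSeries τ ℤ_[p]} (ha : ZeroConst a) (hb : ZeroConst b) :
    logOf L (comp F (Sum.elim a b)) = logOf L a + logOf L b := by
  have hab := ha.sumElim hb
  rw [LubinTateTwo.logOf_comp L hF.zeroConst hab, hF.logOf_eq, comp_add _ _ hab.toQp,
    comp_comp _ (zeroConst_X_comp _) hab.toQp, comp_comp _ (zeroConst_X_comp _) hab.toQp,
    comp_variables _ hab.toQp, comp_variables _ hab.toQp, toQp_sumElim]
  rfl

/-- `L(X)` and `L(Y)` have the type of `L`, hence so does their sum, and the functional equation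
lemma makes `F` integral. -/
theorem IsTypedLog.exists_hasLog (hL : IsTypedLog N s L) : ∃ F, HasLog F L := by
  obtain ⟨F, hF, h⟩ := hL.exists_logOf_eq
    ((hL.hasType_logOf (zeroConst_X_comp (Sum.inl : ι → ι ⊕ ι))).add
      (hL.hasType_logOf (zeroConst_X_comp (Sum.inr : ι → ι ⊕ ι))))
  simp only [logOf, toQp_variables] at h
  exact ⟨F, hF, h⟩

namespace HasLog

variable {F G : ι → MvPowerSeries (ι ⊕ ι) ℤ_[p]}

theorem toQp_eq (hL : IsTypedLog N s L) (hF : HasLog F L) : toQp p F = ofLog L :=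
  hL.toQp_eq_comp_compInv hF.zeroConst hF.logOf_eq

omit [Fintype ι] [DecidableEq ι] in
theorem zeroConst_comp [Finite ι] (hF : HasLog F L) {a b : ι → MvPowerSeries τ ℤ_[p]}
    (ha : ZeroConst a) (hb : ZeroConst b) : ZeroConst (comp F (Sum.elim a b)) :=
  hF.zeroConst.comp (ha.sumElim hb)

theorem comp_assoc (hL : IsTypedLog N s L) (hF : HasLog F L)
    {a b c : ι → MvPowerSeries τ ℤ_[p]} (ha : ZeroConst a) (hb : ZeroConst b)
    (hc : ZeroConst c) :
    comp F (Sum.elim (comp F (Sum.elim a b)) c) = comp F (Sum.elim a (comp F (Sum.elim b c))) := by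
  refine hL.logOf_injective (hF.zeroConst_comp (hF.zeroConst_comp ha hb) hc)
    (hF.zeroConst_comp ha (hF.zeroConst_comp hb hc)) ?_
  rw [hF.logOf_comp (hF.zeroConst_comp ha hb) hc, hF.logOf_comp ha hb,
    hF.logOf_comp ha (hF.zeroConst_comp hb hc), hF.logOf_comp hb hc, add_assoc]

theorem comp_comm (hL : IsTypedLog N s L) (hF : HasLog F L)
    {a b : ι → MvPowerSeries τ ℤ_[p]} (ha : ZeroConst a) (hb : ZeroConst b) :
    comp F (Sum.elim a b) = comp F (Sum.elim b a) := by
  refine hL.logOf_injective (hF.zeroConst_comp ha hb) (hF.zeroConst_comp hb ha) ?_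
  rw [hF.logOf_comp ha hb, hF.logOf_comp hb ha, add_comm]

theorem comp_zero_right (hL : IsTypedLog N s L) (hF : HasLog F L)
    {a : ι → MvPowerSeries τ ℤ_[p]} (ha : ZeroConst a) : comp F (Sum.elim a 0) = a := by
  refine hL.logOf_injective (hF.zeroConst_comp ha zeroConst_zero) ha ?_
  rw [hF.logOf_comp ha zeroConst_zero, hL.logOf_zero, add_zero]

theorem comp_eq_zero_iff (hL : IsTypedLog N s L) (hF : HasLog F L)
    {a b : ι → MvPowerSeries τ ℤ_[p]} (ha : ZeroConst a) (hb : ZeroConst b) :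
    comp F (Sum.elim a b) = 0 ↔ logOf L b = -logOf L a := by
  rw [eq_neg_iff_add_eq_zero, add_comm, ← hF.logOf_comp ha hb, ← hL.logOf_zero]
  exact ⟨fun h => by rw [h], hL.logOf_injective (hF.zeroConst_comp ha hb) zeroConst_zero⟩

theorem isFormalGroup (hL : IsTypedLog N s L) (hF : HasLog F L) : IsFormalGroup F where
  linear := by
    intro k d hd
    let Y : ι → MvPowerSeries (ι ⊕ ι) ℤ_[p] := fun j => X (Sum.inl j)
    let Z : ι → MvPowerSeries (ι ⊕ ι) ℤ_[p] := fun j => X (Sum.inr j)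
    have hY : ZeroConst Y := zeroConst_X_comp _
    have hZ : ZeroConst Z := zeroConst_X_comp _
    have h0 : ∀ {a b : ι → MvPowerSeries (ι ⊕ ι) ℚ_[p]}, ZeroConst a → ZeroConst b → ∀ k,
        (comp L a - comp L b - matMul (jacobian L) (a - b)) k ∈
          lowDegIdeal (ι ⊕ ι) ℚ_[p] 2 := fun ha hb =>
      comp_sub_comp_sub_mem hL.zeroConst ha hb (n := 1)
        fun j => mem_lowDegIdeal_one ((ha.sub hb) j)
    -- With `L(F) - L(Y) = L(Z) - L(0)`, comparing the two first order expansions gives `J(F - Y) ≡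
    -- J Z` modulo degree two.
    have h1 := h0 hF.zeroConst.toQp hY.toQp
    have h2 := h0 hZ.toQp zeroConst_zero
    have h3 : comp L (toQp p F) = comp L (toQp p Y) + comp L (toQp p Z) := by
      rw [toQp_variables, toQp_variables]
      exact hF.logOf_eq
    have h4 : ∀ k, (toQp p (F - (Y + Z))) k ∈ lowDegIdeal (ι ⊕ ι) ℚ_[p] 2 := by
      refine mem_lowDegIdeal_of_matMul hL.isUnit_jacobian fun k => ?_
      have h5 : matMul (jacobian L) (toQp p (F - (Y + Z))) =
          (comp L (toQp p Z) - comp L 0 - matMul (jacobian L) (toQp p Z - 0)) -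
          (comp L (toQp p F) - comp L (toQp p Y) -
            matMul (jacobian L) (toQp p F - toQp p Y)) := by
        rw [h3, comp_zero hL.zeroConst, toQp_sub, toQp_add, ← sub_sub, matMul_sub]
        simp only [sub_zero]
        abel
      rw [h5]
      exact Ideal.sub_mem _ (h2 k) (h1 k)
    have h6 := toQp_mem_lowDegIdeal.mp (h4 k) d hd
    rw [Pi.sub_apply, map_sub] at h6
    exact sub_eq_zero.mp h6
  assoc := hF.comp_assoc hL (zeroConst_X_comp _)
    (zeroConst_X_comp (fun j => Sum.inr (Sum.inl j))) (zeroConst_X_comp _)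
  right_id := hF.comp_zero_right hL zeroConst_X
  left_id := by
    rw [hF.comp_comm hL zeroConst_zero zeroConst_X]
    exact hF.comp_zero_right hL zeroConst_X
  inverse := by
    -- The inverse is `L⁻¹(-L)`, integral because `-L` is again typed.
    obtain ⟨ν, hν, h⟩ := hL.exists_logOf_eq (hL.hasType.smul (-1))
    have h' : logOf L ν = -logOf L X := by simpa [logOf_X] using h
    refine ⟨ν, ⟨hν, ?_, ?_⟩, ?_⟩
    · exact (hF.comp_eq_zero_iff hL zeroConst_X hν).mpr h'
    · rw [hF.comp_comm hL hν zeroConst_X]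
      exact (hF.comp_eq_zero_iff hL zeroConst_X hν).mpr h'
    · rintro μ ⟨hμ, h1, -⟩
      refine hL.logOf_injective hμ hν ?_
      rw [h', (hF.comp_eq_zero_iff hL zeroConst_X hμ).mp h1]

/-- Under `L'` both sides become `L(X) + L(Y)`. -/
theorem isHom (hL' : IsTypedLog N s L') (hF : HasLog F L)
    (hG : HasLog G L') {f : ι → MvPowerSeries ι ℤ_[p]} (hf : ZeroConst f)
    (h : logOf L' f = L) : IsHom F G f := by
  have h1 : ∀ {a : ι → MvPowerSeries (ι ⊕ ι) ℤ_[p]}, ZeroConst a →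
      logOf L' (comp f a) = logOf L a := fun ha => by
    rw [LubinTateTwo.logOf_comp L' hf ha, h, logOf]
  have hX := zeroConst_X_comp (R := ℤ_[p]) (Sum.inl : ι → ι ⊕ ι)
  have hY := zeroConst_X_comp (R := ℤ_[p]) (Sum.inr : ι → ι ⊕ ι)
  refine ⟨hf, hL'.logOf_injective (hf.comp hF.zeroConst)
    (hG.zeroConst_comp (hf.comp hX) (hf.comp hY)) ?_⟩
  rw [hG.logOf_comp (hf.comp hX) (hf.comp hY), h1 hX, h1 hY, h1 hF.zeroConst, hF.logOf_eq,
    logOf, logOf, toQp_variables, toQp_variables]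

omit [DecidableEq ι] in
theorem zeroConst_nmul (hF : HasLog F L) (n : ℕ) : ZeroConst (nmul F n) := by
  induction n with
  | zero => exact zeroConst_zero
  | succ n ih => exact hF.zeroConst_comp zeroConst_X ih

theorem logOf_nmul (hL : IsTypedLog N s L) (hF : HasLog F L) (n : ℕ) :
    logOf L (nmul F n) = (n : ℚ_[p]) • L := by
  induction n with
  | zero => rw [nmul, hL.logOf_zero, Nat.cast_zero, zero_smul]
  | succ n ih =>
    rw [nmul, hF.logOf_comp zeroConst_X (hF.zeroConst_nmul n), ih, logOf_X, Nat.cast_succ,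
      add_smul, one_smul, add_comm]

end HasLog

/-- The hypothesis of a common type is symmetric in `L` and `L'`, so `L⁻¹(L')` is integral too and
gives the inverse. -/
theorem IsTypedLog.isIso {F G : ι → MvPowerSeries (ι ⊕ ι) ℤ_[p]} (hL : IsTypedLog N s L)
    (hL' : IsTypedLog N s L') (hF : HasLog F L) (hG : HasLog G L')
    {f : ι → MvPowerSeries ι ℤ_[p]} (hf : ZeroConst f) (h : logOf L' f = L) : IsIso F G f := by
  obtain ⟨g, hg, h'⟩ := hL.exists_logOf_eq hL'.hasType
  refine ⟨hF.isHom hL' hG hf h, g, hG.isHom hL hF hg h', ?_, ?_⟩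
  · refine hL'.logOf_injective (hf.comp hg) zeroConst_X ?_
    rw [logOf_comp L' hf hg, h, logOf_X]
    exact h'
  · refine hL.logOf_injective (hg.comp hf) zeroConst_X ?_
    rw [logOf_comp L hg hf, h', logOf_X]
    exact h

/-- The integral tuple `[a](X) = L⁻¹(a L(X))`. -/
theorem IsTypedLog.exists_logOf_eq_smul (hL : IsTypedLog N s L) (a : ℤ_[p]) :
    ∃ m : ι → MvPowerSeries ι ℤ_[p], ZeroConst m ∧ logOf L m = (a : ℚ_[p]) • L :=
  hL.exists_logOf_eq (hL.hasType.smul a)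

end Logarithm

/-! ### Convergence and evaluation on the open unit polydisc. -/

section Evaluation

variable {p : ℕ} [hp : Fact p.Prime] {ι κ τ : Type}

/-- All coordinates of the point lie in the open unit ball. -/
def IsSmall (x : κ → PadicAlgCl p) : Prop := ∀ j, ‖x j‖ < 1

/-- A family in a finite-dimensional subspace of `PadicAlgCl p` that is dominated by powers of some
`ρ < 1` is summable. -/
theorem summable_of_norm_le_pow {α : Type} (E : Submodule ℚ_[p] (PadicAlgCl p))
    [FiniteDimensional ℚ_[p] E] {u : α → PadicAlgCl p} (hE : ∀ a, u a ∈ E) (deg : α → ℕ)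
    (hfin : ∀ n, {a | u a ≠ 0 ∧ deg a ≤ n}.Finite) {ρ : ℝ} (h0 : 0 ≤ ρ) (h1 : ρ < 1)
    (hu : ∀ a, ‖u a‖ ≤ ρ ^ deg a) : Summable u := by
  -- The algebraic closure is not complete, so the sum is formed in `E`. There the ultrametric
  -- inequality reduces summability to terms tending to zero.
  have : CompleteSpace E := FiniteDimensional.complete ℚ_[p] E
  let v : α → E := fun a => ⟨u a, hE a⟩
  have hv : Summable v := by
    refine NonarchimedeanAddGroup.summable_of_tendsto_cofinite_zero ?_
    rw [NormedAddGroup.tendsto_nhds_zero]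
    intro ε hε
    obtain ⟨n, hn⟩ := exists_pow_lt_of_lt_one hε h1
    refine (hfin n).subset fun a ha => ?_
    have ha' : ε ≤ ‖u a‖ := not_lt.mp ha
    refine ⟨norm_pos_iff.mp (hε.trans_le ha'), ?_⟩
    by_contra hlt
    have h2 := pow_le_pow_of_le_one h0 h1.le (not_le.mp hlt).le
    linarith [hu a]
  exact hv.map E.subtype continuous_subtype_val

/-- The value at `x` of the monomial of exponent `d`. -/
noncomputable def monomialAt (x : κ → PadicAlgCl p) (d : κ →₀ ℕ) : PadicAlgCl p :=
  d.prod fun j m => x j ^ m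

theorem monomialAt_add (x : κ → PadicAlgCl p) (d e : κ →₀ ℕ) :
    monomialAt x (d + e) = monomialAt x d * monomialAt x e := by
  classical
  exact Finsupp.prod_add_index' (by simp) (by intros; rw [pow_add])

theorem norm_monomialAt_le {x : κ → PadicAlgCl p} {ρ : ℝ} (hx : ∀ j, ‖x j‖ ≤ ρ) (d : κ →₀ ℕ) :
    ‖monomialAt x d‖ ≤ ρ ^ d.degree := by
  rw [monomialAt, Finsupp.prod, norm_prod, Finsupp.degree_apply, ← Finset.prod_pow_eq_pow_sum]
  refine Finset.prod_le_prod (fun j _ => norm_nonneg _) fun j _ => ?_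
  rw [norm_pow]
  exact pow_le_pow_left₀ (norm_nonneg _) (hx j) _

/-- An integer of `ℚ_[p]`, viewed in the algebraic closure. -/
noncomputable def intCoe (p : ℕ) [Fact p.Prime] : ℤ_[p] →+* PadicAlgCl p :=
  (algebraMap ℚ_[p] (PadicAlgCl p)).comp PadicInt.Coe.ringHom

theorem norm_intCoe_le (a : ℤ_[p]) : ‖intCoe p a‖ ≤ 1 := by
  rw [intCoe, RingHom.comp_apply, norm_algebraMap']
  exact a.norm_le_one

/-- The finite extension of `ℚ_[p]` generated by the coordinates of a point. -/
noncomputable def pointField (x : κ → PadicAlgCl p) : IntermediateField ℚ_[p] (PadicAlgCl p) :=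
  IntermediateField.adjoin ℚ_[p] (Set.range x)

instance [Finite κ] (x : κ → PadicAlgCl p) :
    FiniteDimensional ℚ_[p] (Subalgebra.toSubmodule (pointField x).toSubalgebra) :=
  IntermediateField.finiteDimensional_adjoin (K := ℚ_[p]) (S := Set.range x)
    fun _ _ => Algebra.IsIntegral.isIntegral _

/-- Puts all terms of a series in one finite extension of `ℚ_[p]`, where the convergence criterion
applies. -/
theorem intCoe_mul_monomialAt_mem (x : κ → PadicAlgCl p) (a : ℤ_[p]) (d : κ →₀ ℕ) :
    intCoe p a * monomialAt x d ∈ Subalgebra.toSubmodule (pointField x).toSubalgebra := by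
  refine (pointField x).mul_mem ((pointField x).algebraMap_mem _)
    ((pointField x).prod_mem fun j _ => pow_mem (S := pointField x) ?_ _)
  exact IntermediateField.subset_adjoin _ _ (Set.mem_range_self j)

theorem norm_intCoe_mul_monomialAt_le {x : κ → PadicAlgCl p} {ρ : ℝ} (hx : ∀ j, ‖x j‖ ≤ ρ)
    (a : ℤ_[p]) (d : κ →₀ ℕ) : ‖intCoe p a * monomialAt x d‖ ≤ ρ ^ d.degree := by
  rw [norm_mul]
  exact (mul_le_of_le_one_left (norm_nonneg _) (norm_intCoe_le a)).trans (norm_monomialAt_le hx d)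

/-- The value of an integral power series at a point. -/
noncomputable def evalSeries (x : κ → PadicAlgCl p) (f : MvPowerSeries κ ℤ_[p]) : PadicAlgCl p :=
  ∑' d : κ →₀ ℕ, intCoe p (coeff d f) * monomialAt x d

theorem evalSeries_monomial (x : κ → PadicAlgCl p) (d : κ →₀ ℕ) (a : ℤ_[p]) :
    evalSeries x (monomial d a) = intCoe p a * monomialAt x d := by
  classical
  rw [evalSeries, tsum_eq_single d]
  · rw [coeff_monomial_same]
  · intro e he
    rw [coeff_monomial_ne he, map_zero, zero_mul]

/-- The value of an integral tuple of power series at a point. -/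
noncomputable def evalAt (f : ι → MvPowerSeries κ ℤ_[p]) (x : κ → PadicAlgCl p) :
    ι → PadicAlgCl p := fun k => evalSeries x (f k)

theorem evalTuple_toQp (f : ι → MvPowerSeries κ ℤ_[p]) (x : κ → PadicAlgCl p) :
    evalTuple p (toQp p f) x = evalAt f x := by
  funext k
  refine tsum_congr fun d => ?_
  rw [coeff_toQp]
  rfl

theorem prod_pow_mem_lowDegIdeal_degree {a : κ → MvPowerSeries τ ℤ_[p]} (ha : ZeroConst a)
    (e : κ →₀ ℕ) : (e.prod fun j m => a j ^ m) ∈ lowDegIdeal τ ℤ_[p] e.degree := by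
  generalize hn : e.degree = n
  induction n generalizing e with
  | zero => exact fun d hd => absurd hd (Nat.not_lt_zero _)
  | succ n ih =>
    obtain ⟨j, c, rfl⟩ := exists_eq_single_add (d := e) (by rintro rfl; simp at hn)
    rw [map_add, Finsupp.degree_single] at hn
    rw [prod_pow_single_add, add_comm n]
    exact mul_mem_lowDegIdeal (mem_lowDegIdeal_one (ha j)) (ih c (by omega))

theorem evalAt_variables (e : ι → κ) (x : κ → PadicAlgCl p) :
    evalAt (fun j => (X (e j) : MvPowerSeries κ ℤ_[p])) x = x ∘ e := by
  funext k
  rw [evalAt, X, evalSeries_monomial, map_one, one_mul, monomialAt]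
  simp

theorem evalAt_X (x : κ → PadicAlgCl p) : evalAt (X : κ → MvPowerSeries κ ℤ_[p]) x = x :=
  evalAt_variables id x

theorem evalAt_zero (x : κ → PadicAlgCl p) :
    evalAt (0 : ι → MvPowerSeries κ ℤ_[p]) x = 0 := by
  funext k
  simp [evalAt, evalSeries]

theorem evalAt_sumElim {ι' : Type} (f : ι → MvPowerSeries κ ℤ_[p])
    (g : ι' → MvPowerSeries κ ℤ_[p]) (x : κ → PadicAlgCl p) :
    evalAt (Sum.elim f g) x = Sum.elim (evalAt f x) (evalAt g x) := by
  funext k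
  rcases k with k | k <;> rfl

theorem IsSmall.sumElim {x : κ → PadicAlgCl p} {y : τ → PadicAlgCl p} (hx : IsSmall x)
    (hy : IsSmall y) : IsSmall (Sum.elim x y) := by
  rintro (j | j)
  exacts [hx j, hy j]

variable [Fintype κ] [Fintype τ]

theorem IsSmall.norm_lt_one {x : κ → PadicAlgCl p} (hx : IsSmall x) : ‖x‖ < 1 :=
  (pi_norm_lt_iff one_pos).mpr hx

/-- Families of integral multiples of monomials, finite in each degree, are summable. -/
theorem IsSmall.summable {α : Type} {x : κ → PadicAlgCl p} (hx : IsSmall x) (c : α → ℤ_[p])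
    (d : α → κ →₀ ℕ) (hfin : ∀ n, {a | c a ≠ 0 ∧ (d a).degree ≤ n}.Finite) :
    Summable fun a => intCoe p (c a) * monomialAt x (d a) := by
  refine summable_of_norm_le_pow _ (fun a => intCoe_mul_monomialAt_mem x (c a) (d a))
    (fun a => (d a).degree) (fun n => (hfin n).subset fun a ha => ⟨fun h0 => ha.1 ?_, ha.2⟩)
    (norm_nonneg x) hx.norm_lt_one
    fun a => norm_intCoe_mul_monomialAt_le (norm_le_pi_norm x) _ _
  simp [h0]

theorem IsSmall.summable_evalSeries {x : κ → PadicAlgCl p} (hx : IsSmall x)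
    (f : MvPowerSeries κ ℤ_[p]) : Summable fun d => intCoe p (coeff d f) * monomialAt x d :=
  hx.summable (fun d => coeff d f) id fun n =>
    (Finsupp.finite_of_degree_le n).subset fun _ ha => ha.2

theorem IsSmall.hasSum_evalSeries {x : κ → PadicAlgCl p} (hx : IsSmall x)
    (f : MvPowerSeries κ ℤ_[p]) :
    HasSum (fun d => intCoe p (coeff d f) * monomialAt x d) (evalSeries x f) :=
  (hx.summable_evalSeries f).hasSum

theorem IsSmall.evalSeries_mul {x : κ → PadicAlgCl p} (hx : IsSmall x)
    (f g : MvPowerSeries κ ℤ_[p]) : evalSeries x (f * g) = evalSeries x f * evalSeries x g := by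
  classical
  have h : Summable fun q : (κ →₀ ℕ) × (κ →₀ ℕ) =>
      (intCoe p (coeff q.1 f) * monomialAt x q.1) * (intCoe p (coeff q.2 g) * monomialAt x q.2) := by
    refine (hx.summable (fun q : (κ →₀ ℕ) × (κ →₀ ℕ) => coeff q.1 f * coeff q.2 g)
      (fun q => q.1 + q.2) fun n => ?_).congr fun q => ?_
    · refine ((Finsupp.finite_of_degree_le n).prod (Finsupp.finite_of_degree_le n)).subset
        fun q hq => ?_
      have h2 := hq.2
      simp only [map_add] at h2
      exact ⟨(by omega : q.1.degree ≤ n), (by omega : q.2.degree ≤ n)⟩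
    · rw [map_mul, monomialAt_add]
      ring
  rw [evalSeries, evalSeries, evalSeries,
    (hx.summable_evalSeries f).tsum_mul_tsum_eq_tsum_sum_antidiagonal
      (hx.summable_evalSeries g) h]
  refine tsum_congr fun d => ?_
  rw [coeff_mul, map_sum, Finset.sum_mul]
  refine Finset.sum_congr rfl fun q hq => ?_
  rw [← Finset.HasAntidiagonal.mem_antidiagonal.mp hq, map_mul, monomialAt_add]
  ring

/-- Evaluation at a point of the open unit polydisc. -/
noncomputable def IsSmall.evalHom {x : κ → PadicAlgCl p} (hx : IsSmall x) :
    MvPowerSeries κ ℤ_[p] →+* PadicAlgCl p where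
  toFun := evalSeries x
  map_one' := by
    have := evalSeries_monomial x 0 1
    rw [monomial_zero_one, map_one, one_mul, monomialAt, Finsupp.prod_zero_index] at this
    exact this
  map_mul' := hx.evalSeries_mul
  map_zero' := by simp [evalSeries]
  map_add' f g := by
    rw [evalSeries, evalSeries, evalSeries,
      ← (hx.summable_evalSeries f).tsum_add (hx.summable_evalSeries g)]
    exact tsum_congr fun d => by rw [map_add, map_add, add_mul]

theorem IsSmall.evalHom_apply {x : κ → PadicAlgCl p} (hx : IsSmall x)
    (f : MvPowerSeries κ ℤ_[p]) : hx.evalHom f = evalSeries x f := rfl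

/-- Every nonconstant term is bounded by the sup norm `‖x‖ < 1`, and the ultrametric inequality
passes this uniform bound to the sum. -/
theorem IsSmall.norm_evalSeries_lt_one {x : κ → PadicAlgCl p} (hx : IsSmall x)
    {f : MvPowerSeries κ ℤ_[p]} (hf : constantCoeff f = 0) : ‖evalSeries x f‖ < 1 := by
  refine (IsUltrametricDist.norm_tsum_le_of_forall_le_of_nonneg (norm_nonneg x)
    fun d => ?_).trans_lt hx.norm_lt_one
  by_cases hd : d = 0
  · rw [hd, coeff_zero_eq_constantCoeff_apply, hf, map_zero, zero_mul, norm_zero]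
    exact norm_nonneg x
  · refine (norm_intCoe_mul_monomialAt_le (norm_le_pi_norm x) _ _).trans
      (pow_le_of_le_one (norm_nonneg _) hx.norm_lt_one.le ?_)
    rwa [Ne, Finsupp.degree_eq_zero_iff]

theorem IsSmall.evalAt {x : κ → PadicAlgCl p} (hx : IsSmall x) {f : ι → MvPowerSeries κ ℤ_[p]}
    (hf : ZeroConst f) : IsSmall (evalAt f x) := fun k => hx.norm_evalSeries_lt_one (hf k)

/-- A double series indexed by the exponents `d` of the result and `e` of `f` is summed in both
orders. -/
theorem IsSmall.evalSeries_subst {x : τ → PadicAlgCl p} (hx : IsSmall x)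
    (f : MvPowerSeries κ ℤ_[p]) {a : κ → MvPowerSeries τ ℤ_[p]} (ha : ZeroConst a) :
    evalSeries x (f.subst a) = evalSeries (LubinTateTwo.evalAt a x) f := by
  let M : (κ →₀ ℕ) → MvPowerSeries τ ℤ_[p] := fun e => e.prod fun j m => a j ^ m
  let u : (τ →₀ ℕ) × (κ →₀ ℕ) → PadicAlgCl p := fun q =>
    intCoe p (coeff q.2 f * coeff q.1 (M q.2)) * monomialAt x q.1
  have hM : ∀ e (d : τ →₀ ℕ), d.degree < e.degree → coeff d (M e) = 0 := fun e d hd =>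
    prod_pow_mem_lowDegIdeal_degree ha e d hd
  -- The monomial `a ^ e` has order at least the degree of `e`, so only finitely many pairs
  -- contribute with `d` of bounded degree.
  have hu : Summable u := by
    refine hx.summable (fun q : (τ →₀ ℕ) × (κ →₀ ℕ) => coeff q.2 f * coeff q.1 (M q.2))
      (fun q => q.1) fun n => ?_
    refine ((Finsupp.finite_of_degree_le n).prod (Finsupp.finite_of_degree_le n)).subset
      fun q hq => ⟨hq.2, ?_⟩
    by_contra hlt
    have hlt' : n < q.2.degree := not_le.mp hlt
    exact hq.1 (by rw [hM _ _ (lt_of_le_of_lt hq.2 hlt'), mul_zero])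
  have h1 : HasSum (fun d => intCoe p (coeff d (f.subst a)) * monomialAt x d) (∑' q, u q) := by
    refine hu.hasSum.prod_fiberwise fun d => HasSum.mul_right _ ?_
    have hfin := coeff_subst_finite ha.hasSubst f d
    have h2 : intCoe p (coeff d (f.subst a)) =
        ∑ᶠ e, intCoe p (coeff e f * coeff d (M e)) := by
      rw [coeff_subst ha.hasSubst]
      exact (intCoe p).toAddMonoidHom.map_finsum hfin
    have hfin' : (fun e => intCoe p (coeff e f * coeff d (M e))).HasFiniteSupport :=
      hfin.subset fun e he h0 => he (by
        have h3 : coeff e f * coeff d (M e) = 0 := h0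
        simp only [h3, map_zero])
    rw [h2, ← tsum_eq_finsum (L := SummationFilter.unconditional _) hfin']
    exact (summable_of_hasFiniteSupport hfin').hasSum
  have h2 : HasSum (fun e => intCoe p (coeff e f) * monomialAt (LubinTateTwo.evalAt a x) e)
      (∑' q, u q) := by
    refine ((Equiv.prodComm _ _).hasSum_iff.mpr hu.hasSum).prod_fiberwise fun e => ?_
    have h3 : monomialAt (LubinTateTwo.evalAt a x) e = evalSeries x (M e) := by
      rw [← hx.evalHom_apply, map_finsuppProd]
      simp only [map_pow]
      rfl
    rw [h3]
    have h4 : (fun d => (u ∘ Equiv.prodComm (κ →₀ ℕ) (τ →₀ ℕ)) (e, d)) =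
        fun d => intCoe p (coeff e f) * (intCoe p (coeff d (M e)) * monomialAt x d) := by
      funext d
      change u (d, e) = _
      simp only [u, map_mul, mul_assoc]
    rw [h4]
    exact (hx.hasSum_evalSeries (M e)).mul_left (intCoe p (coeff e f))
  rw [evalSeries, h1.tsum_eq, evalSeries, h2.tsum_eq]

theorem IsSmall.evalAt_comp {x : τ → PadicAlgCl p} (hx : IsSmall x)
    (f : ι → MvPowerSeries κ ℤ_[p]) {a : κ → MvPowerSeries τ ℤ_[p]} (ha : ZeroConst a) :
    LubinTateTwo.evalAt (comp f a) x = LubinTateTwo.evalAt f (LubinTateTwo.evalAt a x) :=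
  funext fun k => hx.evalSeries_subst (f k) ha

end Evaluation

/-! ### The `ℤ_[p]`-module of points of a formal group. -/

section Points

/-- A formal group over `ℤ_[p]` together with its typed logarithm. -/
structure LogFormalGroup (p : ℕ) [Fact p.Prime] (ι : Type) [Fintype ι] [DecidableEq ι] where
  /-- the cut-off of the functional equation -/
  N : ℕ
  /-- the data of the functional equation -/
  s : ℕ → Matrix ι ι ℚ_[p]
  /-- the logarithm -/
  log : ι → MvPowerSeries ι ℚ_[p]
  /-- the formal group -/
  law : ι → MvPowerSeries (ι ⊕ ι) ℤ_[p]
  isTypedLog : IsTypedLog N s log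
  hasLog : HasLog law log

namespace LogFormalGroup

variable {p : ℕ} [hp : Fact p.Prime] {ι τ : Type} [Fintype ι] [DecidableEq ι]
  (D E : LogFormalGroup p ι)

/-- The multiplication `[a](X)`. -/
noncomputable def mul (a : ℤ_[p]) : ι → MvPowerSeries ι ℤ_[p] :=
  (D.isTypedLog.exists_logOf_eq_smul a).choose

theorem zeroConst_mul (a : ℤ_[p]) : ZeroConst (D.mul a) :=
  (D.isTypedLog.exists_logOf_eq_smul a).choose_spec.1

theorem logOf_mul (a : ℤ_[p]) : logOf D.log (D.mul a) = (a : ℚ_[p]) • D.log :=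
  (D.isTypedLog.exists_logOf_eq_smul a).choose_spec.2

theorem toQp_mul (a : ℤ_[p]) : toQp p (D.mul a) = logMul D.log (a : ℚ_[p]) :=
  D.isTypedLog.toQp_eq_comp_compInv (D.zeroConst_mul a) (D.logOf_mul a)

/-- The tuple `[a]` is determined by its logarithm, so the rules for sums and products of scalars
reduce to those for multiples of `D.log`. -/
theorem eq_mul {a : ℤ_[p]} {m : ι → MvPowerSeries ι ℤ_[p]} (hm : ZeroConst m)
    (h : logOf D.log m = (a : ℚ_[p]) • D.log) : m = D.mul a :=
  D.isTypedLog.logOf_injective hm (D.zeroConst_mul a) (h.trans (D.logOf_mul a).symm)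

theorem logOf_mul_comp (a : ℤ_[p]) {m : ι → MvPowerSeries τ ℤ_[p]} (hm : ZeroConst m) :
    logOf D.log (comp (D.mul a) m) = (a : ℚ_[p]) • logOf D.log m := by
  rw [logOf_comp D.log (D.zeroConst_mul a) hm, D.logOf_mul, comp_smul _ _ hm.toQp, logOf]

theorem X_eq_mul_one : X = D.mul 1 :=
  D.eq_mul zeroConst_X (by rw [logOf_X, PadicInt.coe_one, one_smul])

theorem zero_eq_mul_zero : 0 = D.mul 0 :=
  D.eq_mul zeroConst_zero (by rw [D.isTypedLog.logOf_zero, PadicInt.coe_zero, zero_smul])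

theorem nmul_eq_mul (n : ℕ) : nmul D.law n = D.mul n :=
  D.eq_mul (D.hasLog.zeroConst_nmul n) (by
    rw [D.hasLog.logOf_nmul D.isTypedLog, PadicInt.coe_natCast])

theorem mul_comp_mul (a b : ℤ_[p]) : comp (D.mul a) (D.mul b) = D.mul (a * b) :=
  D.eq_mul ((D.zeroConst_mul a).comp (D.zeroConst_mul b)) (by
    rw [D.logOf_mul_comp a (D.zeroConst_mul b), D.logOf_mul, smul_smul, PadicInt.coe_mul])

theorem law_comp_mul (a b : ℤ_[p]) :
    comp D.law (Sum.elim (D.mul a) (D.mul b)) = D.mul (a + b) :=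
  D.eq_mul (D.hasLog.zeroConst_comp (D.zeroConst_mul a) (D.zeroConst_mul b)) (by
    rw [D.hasLog.logOf_comp (D.zeroConst_mul a) (D.zeroConst_mul b), D.logOf_mul, D.logOf_mul,
      ← add_smul, PadicInt.coe_add])

theorem mul_comp_law (a : ℤ_[p]) {b c : ι → MvPowerSeries τ ℤ_[p]} (hb : ZeroConst b)
    (hc : ZeroConst c) : comp (D.mul a) (comp D.law (Sum.elim b c)) =
      comp D.law (Sum.elim (comp (D.mul a) b) (comp (D.mul a) c)) := by
  have hab := (D.zeroConst_mul a).comp hb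
  have hac := (D.zeroConst_mul a).comp hc
  have hbc := D.hasLog.zeroConst_comp hb hc
  refine D.isTypedLog.logOf_injective ((D.zeroConst_mul a).comp hbc)
    (D.hasLog.zeroConst_comp hab hac) ?_
  rw [D.logOf_mul_comp a hbc, D.hasLog.logOf_comp hb hc, D.hasLog.logOf_comp hab hac,
    D.logOf_mul_comp a hb, D.logOf_mul_comp a hc, smul_add]

theorem evalAt_law_comp [Fintype τ] {a b : ι → MvPowerSeries τ ℤ_[p]} (ha : ZeroConst a)
    (hb : ZeroConst b) {x : τ → PadicAlgCl p} (hx : IsSmall x) :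
    evalAt (comp D.law (Sum.elim a b)) x =
      evalAt D.law (Sum.elim (evalAt a x) (evalAt b x)) := by
  rw [hx.evalAt_comp _ (ha.sumElim hb), evalAt_sumElim]

/-- The points of the formal group with coordinates in the maximal ideal. -/
def Points (_ : LogFormalGroup p ι) : Type := {x : ι → PadicAlgCl p // IsSmall x}

variable {D E}

/-- The coordinates of a point. -/
def Points.coords (x : D.Points) : ι → PadicAlgCl p := x.1

theorem Points.isSmall (x : D.Points) : IsSmall x.coords := x.2

theorem Points.ext {x y : D.Points} (h : x.coords = y.coords) : x = y := Subtype.ext h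

noncomputable instance : Zero D.Points := ⟨⟨0, fun _ => by simp⟩⟩

noncomputable instance : Add D.Points :=
  ⟨fun x y => ⟨evalAt D.law (Sum.elim x.coords y.coords),
    (x.isSmall.sumElim y.isSmall).evalAt D.hasLog.zeroConst⟩⟩

noncomputable instance : SMul ℤ_[p] D.Points :=
  ⟨fun a x => ⟨evalAt (D.mul a) x.coords, x.isSmall.evalAt (D.zeroConst_mul a)⟩⟩

noncomputable instance : Neg D.Points := ⟨fun x => (-1 : ℤ_[p]) • x⟩

namespace Points

theorem coords_zero : (0 : D.Points).coords = 0 := rfl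

theorem coords_smul (a : ℤ_[p]) (x : D.Points) : (a • x).coords = evalAt (D.mul a) x.coords := rfl

theorem neg_def (x : D.Points) : -x = (-1 : ℤ_[p]) • x := rfl

/-- Like the other axioms, this is a formal identity in independent variables, evaluated at the
concatenated coordinates of the points. -/
protected theorem add_comm (x y : D.Points) : x + y = y + x := by
  refine Points.ext ?_
  have hX := zeroConst_X_comp (R := ℤ_[p]) (Sum.inl : ι → ι ⊕ ι)
  have hY := zeroConst_X_comp (R := ℤ_[p]) (Sum.inr : ι → ι ⊕ ι)
  have h := congrArg (fun f => evalAt f (Sum.elim x.coords y.coords))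
    (D.hasLog.comp_comm D.isTypedLog hX hY)
  have hxy := x.isSmall.sumElim y.isSmall
  simp only [D.evalAt_law_comp hX hY hxy, D.evalAt_law_comp hY hX hxy, evalAt_variables,
    Sum.elim_comp_inl, Sum.elim_comp_inr] at h
  exact h

protected theorem add_assoc (x y z : D.Points) : x + y + z = x + (y + z) := by
  refine Points.ext ?_
  have hX := zeroConst_X_comp (R := ℤ_[p]) (Sum.inl : ι → ι ⊕ ι ⊕ ι)
  have hY := zeroConst_X_comp (R := ℤ_[p]) (fun j : ι => (Sum.inr (Sum.inl j) : ι ⊕ ι ⊕ ι))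
  have hZ := zeroConst_X_comp (R := ℤ_[p]) (fun j : ι => (Sum.inr (Sum.inr j) : ι ⊕ ι ⊕ ι))
  have h := congrArg (fun f => evalAt f (Sum.elim x.coords (Sum.elim y.coords z.coords)))
    (D.hasLog.comp_assoc D.isTypedLog hX hY hZ)
  have hxyz := x.isSmall.sumElim (y.isSmall.sumElim z.isSmall)
  simp only [D.evalAt_law_comp (D.hasLog.zeroConst_comp hX hY) hZ hxyz,
    D.evalAt_law_comp hX (D.hasLog.zeroConst_comp hY hZ) hxyz,
    D.evalAt_law_comp hX hY hxyz, D.evalAt_law_comp hY hZ hxyz, evalAt_variables] at h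
  exact h

protected theorem add_zero (x : D.Points) : x + 0 = x := by
  refine Points.ext ?_
  have h := congrArg (fun f => evalAt f x.coords)
    (D.hasLog.comp_zero_right D.isTypedLog zeroConst_X)
  simp only [D.evalAt_law_comp zeroConst_X zeroConst_zero x.isSmall, evalAt_X, evalAt_zero] at h
  exact h

protected theorem add_smul (a b : ℤ_[p]) (x : D.Points) : (a + b) • x = a • x + b • x := by
  refine Points.ext ?_
  rw [coords_smul, ← D.law_comp_mul, D.evalAt_law_comp (D.zeroConst_mul a) (D.zeroConst_mul b)
    x.isSmall]
  rfl

protected theorem one_smul (x : D.Points) : (1 : ℤ_[p]) • x = x :=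
  Points.ext (by rw [coords_smul, ← D.X_eq_mul_one, evalAt_X])

protected theorem zero_smul (x : D.Points) : (0 : ℤ_[p]) • x = 0 :=
  Points.ext (by rw [coords_smul, ← D.zero_eq_mul_zero, evalAt_zero, coords_zero])

protected theorem mul_smul (a b : ℤ_[p]) (x : D.Points) : (a * b) • x = a • b • x :=
  Points.ext (by
    rw [coords_smul, ← D.mul_comp_mul, x.isSmall.evalAt_comp _ (D.zeroConst_mul b)]
    rfl)

protected theorem smul_zero (a : ℤ_[p]) : a • (0 : D.Points) = 0 := by
  rw [← Points.zero_smul 0, ← Points.mul_smul, mul_zero]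

protected theorem smul_add (a : ℤ_[p]) (x y : D.Points) : a • (x + y) = a • x + a • y := by
  refine Points.ext ?_
  have hX := zeroConst_X_comp (R := ℤ_[p]) (Sum.inl : ι → ι ⊕ ι)
  have hY := zeroConst_X_comp (R := ℤ_[p]) (Sum.inr : ι → ι ⊕ ι)
  have ha := D.zeroConst_mul a
  have h := congrArg (fun f => evalAt f (Sum.elim x.coords y.coords)) (D.mul_comp_law a hX hY)
  have hxy := x.isSmall.sumElim y.isSmall
  simp only [hxy.evalAt_comp _ (D.hasLog.zeroConst_comp hX hY), D.evalAt_law_comp hX hY hxy,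
    D.evalAt_law_comp (ha.comp hX) (ha.comp hY) hxy, hxy.evalAt_comp _ hX, hxy.evalAt_comp _ hY,
    evalAt_variables, Sum.elim_comp_inl, Sum.elim_comp_inr] at h
  exact h

protected theorem neg_add_cancel (x : D.Points) : -x + x = 0 := by
  rw [neg_def, ← Points.zero_smul x, ← neg_add_cancel (1 : ℤ_[p]), Points.add_smul,
    Points.one_smul]

noncomputable instance : AddCommGroup D.Points where
  add_assoc := Points.add_assoc
  zero_add x := (Points.add_comm 0 x).trans x.add_zero
  add_zero := Points.add_zero
  add_comm := Points.add_comm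
  nsmul := nsmulRec
  zsmul := zsmulRec
  neg_add_cancel := Points.neg_add_cancel

noncomputable instance : Module ℤ_[p] D.Points where
  one_smul := Points.one_smul
  mul_smul := Points.mul_smul
  smul_zero := Points.smul_zero
  smul_add := Points.smul_add
  add_smul := Points.add_smul
  zero_smul := Points.zero_smul

end Points

omit [DecidableEq ι] in
theorem mapPoints_comp {f g : ι → MvPowerSeries ι ℤ_[p]} (hf : ZeroConst f)
    (hfg : comp g f = X) {x : ι → PadicAlgCl p} (hx : IsSmall x) :
    evalAt g (evalAt f x) = x := by
  rw [← hx.evalAt_comp _ hf, hfg, evalAt_X]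

/-- An integral tuple `f` with `E.log ∘ f = D.log` induces a linear map on points. -/
noncomputable def mapPoints {f : ι → MvPowerSeries ι ℤ_[p]} (hf : ZeroConst f)
    (h : logOf E.log f = D.log) : D.Points →ₗ[ℤ_[p]] E.Points where
  toFun x := ⟨evalAt f x.coords, x.isSmall.evalAt hf⟩
  map_add' x y := by
    refine Points.ext ?_
    have hX := zeroConst_X_comp (R := ℤ_[p]) (Sum.inl : ι → ι ⊕ ι)
    have hY := zeroConst_X_comp (R := ℤ_[p]) (Sum.inr : ι → ι ⊕ ι)
    have hxy := x.isSmall.sumElim y.isSmall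
    change evalAt f (evalAt D.law (Sum.elim x.coords y.coords)) =
      evalAt E.law (Sum.elim (evalAt f x.coords) (evalAt f y.coords))
    rw [← hxy.evalAt_comp _ D.hasLog.zeroConst, (D.hasLog.isHom E.isTypedLog E.hasLog hf h).2,
      E.evalAt_law_comp (hf.comp hX) (hf.comp hY) hxy, hxy.evalAt_comp _ hX,
      hxy.evalAt_comp _ hY, evalAt_variables, evalAt_variables, Sum.elim_comp_inl,
      Sum.elim_comp_inr]
  map_smul' a x := by
    refine Points.ext ?_
    change evalAt f (evalAt (D.mul a) x.coords) = evalAt (E.mul a) (evalAt f x.coords)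
    rw [← x.isSmall.evalAt_comp _ (D.zeroConst_mul a), ← x.isSmall.evalAt_comp _ hf]
    congr 1
    -- Both `f([a]_D)` and `[a]_E(f)` have `E`-logarithm `a • D.log`.
    refine E.isTypedLog.logOf_injective (hf.comp (D.zeroConst_mul a))
      ((E.zeroConst_mul a).comp hf) ?_
    rw [logOf_comp E.log hf (D.zeroConst_mul a), h, E.logOf_mul_comp a hf, h]
    exact D.logOf_mul a

/-- Formal groups whose logarithms have the same type have isomorphic modules of points. -/
theorem exists_pointsEquiv (hN : E.N = D.N) (hs : E.s = D.s) {f : ι → MvPowerSeries ι ℤ_[p]}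
    (hf : ZeroConst f) (h : logOf E.log f = D.log) :
    ∃ e : D.Points ≃ₗ[ℤ_[p]] E.Points, ∀ x, (e x).coords = evalAt f x.coords := by
  have hE : HasType D.N D.s E.log := hN ▸ hs ▸ E.isTypedLog.hasType
  obtain ⟨g, hg, h'⟩ := D.isTypedLog.exists_logOf_eq hE
  have hfg : comp f g = X := by
    refine E.isTypedLog.logOf_injective (hf.comp hg) zeroConst_X ?_
    rw [logOf_comp E.log hf hg, h, logOf_X]
    exact h'
  have hgf : comp g f = X := by
    refine D.isTypedLog.logOf_injective (hg.comp hf) zeroConst_X ?_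
    rw [logOf_comp D.log hg hf, h', logOf_X]
    exact h
  refine ⟨LinearEquiv.ofLinearMap (mapPoints hf h) (mapPoints hg h') ?_ ?_, fun x => rfl⟩
  · exact LinearMap.ext fun x => Points.ext (mapPoints_comp hg hfg x.isSmall)
  · exact LinearMap.ext fun x => Points.ext (mapPoints_comp hf hgf x.isSmall)

end LogFormalGroup

end Points

/-! ### Torsion points as a submodule of the points. -/

section Torsion

variable {p : ℕ} [hp : Fact p.Prime]

namespace LogFormalGroup

/-- The recursively defined `[p ^ n]` acts on points as the scalar `p ^ n`, so the torsion set is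
the kernel of that scalar. -/
theorem evalTuple_nmul (D : LogFormalGroup p (Fin 2)) (n : ℕ) (x : D.Points) :
    evalTuple p (toQp p (nmul D.law (p ^ n))) x.coords = ((p ^ n : ℤ_[p]) • x).coords := by
  rw [evalTuple_toQp, D.nmul_eq_mul, Points.coords_smul]
  push_cast
  rfl

/-- The torsion points of the formal group as a submodule of its points. -/
noncomputable def torsionEquiv (D : LogFormalGroup p (Fin 2)) (n : ℕ) :
    torsion p D.law n ≃ Submodule.torsionBy ℤ_[p] D.Points (p ^ n : ℤ_[p]) where
  toFun x := ⟨⟨x.1, x.2.1⟩, (Submodule.mem_torsionBy_iff _ _).mpr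
    (Points.ext ((D.evalTuple_nmul n ⟨x.1, x.2.1⟩).symm.trans x.2.2))⟩
  invFun y := ⟨y.1.coords, y.1.isSmall, by
    rw [D.evalTuple_nmul, (Submodule.mem_torsionBy_iff _ _).mp y.2]
    rfl⟩
  left_inv _ := rfl
  right_inv _ := rfl

/-- The module structures are transported from the torsion submodules of the points; a linear
equivalence of points restricts to them since it commutes with the scalar `p ^ n`. -/
theorem exists_torsionModules (D E : LogFormalGroup p (Fin 2)) (hN : E.N = D.N) (hs : E.s = D.s)
    {f : Fin 2 → MvPowerSeries (Fin 2) ℤ_[p]} (hf : ZeroConst f) (h : logOf E.log f = D.log)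
    (n : ℕ) :
    ∃ (_ : AddCommGroup (torsion p D.law n)) (_ : Module ℤ_[p] (torsion p D.law n))
      (_ : AddCommGroup (torsion p E.law n)) (_ : Module ℤ_[p] (torsion p E.law n)),
      IsTorsionModule p D.law D.log n ∧ IsTorsionModule p E.law E.log n ∧
      ∃ e : torsion p D.law n ≃ₗ[ℤ_[p]] torsion p E.law n,
        ∀ x : torsion p D.law n, (e x : Fin 2 → PadicAlgCl p) = evalTuple p (toQp p f) x.1 := by
  obtain ⟨Φ, hΦ⟩ := exists_pointsEquiv hN hs hf h
  let a := D.torsionEquiv n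
  let b := E.torsionEquiv n
  let : AddCommGroup (torsion p D.law n) := a.addCommGroup
  let : Module ℤ_[p] (torsion p D.law n) := a.module ℤ_[p]
  let : AddCommGroup (torsion p E.law n) := b.addCommGroup
  let : Module ℤ_[p] (torsion p E.law n) := b.module ℤ_[p]
  have key : ∀ D : LogFormalGroup p (Fin 2),
      @IsTorsionModule p _ D.law D.log n (D.torsionEquiv n).addCommGroup
        ((D.torsionEquiv n).module ℤ_[p]) := by
    intro D
    let : AddCommGroup (torsion p D.law n) := (D.torsionEquiv n).addCommGroup
    let : Module ℤ_[p] (torsion p D.law n) := (D.torsionEquiv n).module ℤ_[p]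
    refine ⟨fun x y => ?_, fun c x => ?_⟩
    · rw [evalTuple_toQp]
      rfl
    · rw [← D.toQp_mul, evalTuple_toQp]
      rfl
  refine ⟨inferInstance, inferInstance, inferInstance, inferInstance, key D, key E, ?_⟩
  have hmap : (Submodule.torsionBy ℤ_[p] D.Points (p ^ n : ℤ_[p])).map
      (Φ : D.Points →ₗ[ℤ_[p]] E.Points) =
      Submodule.torsionBy ℤ_[p] E.Points (p ^ n : ℤ_[p]) := by
    ext y
    rw [Submodule.mem_map_equiv, Submodule.mem_torsionBy_iff, Submodule.mem_torsionBy_iff,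
      ← map_smul, LinearEquiv.map_eq_zero_iff]
  refine ⟨(a.linearEquiv ℤ_[p]).trans ((Φ.ofSubmodules _ _ hmap).trans
    (b.linearEquiv ℤ_[p]).symm), fun x => ?_⟩
  rw [evalTuple_toQp]
  exact hΦ (a x).1

end LogFormalGroup

end Torsion

/-! ### The Lubin–Tate data as a special case, and the theorem. -/

section LubinTateLogarithm

variable {p : ℕ} [hp : Fact p.Prime]

/-- Since `s i` vanishes beyond `N`, the coefficientwise sum over all `i` is an honest finite sum of
tuples. -/
theorem FunctionalEquation.hasTypeWith {ι κ : Type} [Fintype ι] {s : ℕ → Matrix ι ι ℚ_[p]}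
    {g : ι → MvPowerSeries κ ℤ_[p]} {L : ι → MvPowerSeries κ ℚ_[p]}
    (h : FunctionalEquation p s g L) {N : ℕ} (hN : ∀ i, N < i → s i = 0) :
    HasTypeWith N s g L := by
  refine ⟨h.const_L, ?_⟩
  funext k
  ext d
  rw [h.eqn, Pi.add_apply, map_add, frobSum, Finset.sum_apply, map_sum]
  congr 1
  refine (finsum_mem_eq_sum_of_inter_support_eq (s := {i : ℕ | 1 ≤ i}) (t := Finset.Icc 1 N)
    (fun i => ∑ j, s i k j * coeff d (frobExpand p i L j)) ?_).trans ?_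
  · ext i
    simp only [Set.mem_inter_iff, Set.mem_ofPred_eq, Function.mem_support, Finset.coe_Icc,
      Set.mem_Icc]
    refine ⟨fun hi => ⟨⟨hi.1, ?_⟩, hi.2⟩, fun hi => ⟨hi.1.1, hi.2⟩⟩
    by_contra hlt
    exact hi.2 (by simp [hN i (not_le.mp hlt)])
  · refine Finset.sum_congr rfl fun i _ => ?_
    rw [matMul, map_sum]
    exact Finset.sum_congr rfl fun j _ => rfl

theorem ltMatrix_eq_zero {h₁ h₂ i : ℕ} (hi : max h₁ h₂ < i) : ltMatrix p h₁ h₂ i = 0 := by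
  rw [max_lt_iff] at hi
  rw [ltMatrix, if_neg (by omega), if_neg (by omega), add_zero]

theorem ltMatrix_mem_padicBall (h₁ h₂ i : ℕ) (k j : Fin 2) :
    ltMatrix p h₁ h₂ i k j ∈ padicBall p 1 := by
  have hinv : (p : ℚ_[p])⁻¹ ∈ padicBall p 1 := by
    rw [mem_padicBall, norm_inv, Padic.norm_p, inv_inv, zpow_one]
  have h0 : (0 : ℚ_[p]) ∈ padicBall p 1 := zero_mem _
  rw [ltMatrix, Matrix.add_apply]
  refine add_mem ?_ ?_ <;> split_ifs <;> fin_cases k <;> fin_cases j <;> simp [hinv, h0]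

theorem isTypedLog_of_functionalEquation {h₁ h₂ : ℕ} {g : Fin 2 → MvPowerSeries (Fin 2) ℤ_[p]}
    {L : Fin 2 → MvPowerSeries (Fin 2) ℚ_[p]}
    (h : FunctionalEquation p (ltMatrix p h₁ h₂) g L) (hg : IsUnit (jacobian g)) :
    IsTypedLog (max h₁ h₂) (ltMatrix p h₁ h₂) L :=
  ⟨ltMatrix_mem_padicBall h₁ h₂, g, h.hasTypeWith fun _ => ltMatrix_eq_zero, hg⟩

theorem jacobian_X {ι : Type} [DecidableEq ι] {R : Type*} [CommRing R] :
    jacobian (X : ι → MvPowerSeries ι R) = 1 := by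
  ext k j
  simp [jacobian, coeff_X, Matrix.one_apply, Finsupp.single_left_inj, eq_comm]

theorem isTypedLog_ltLog (p : ℕ) [Fact p.Prime] (h₁ h₂ : ℕ) :
    IsTypedLog (max h₁ h₂) (ltMatrix p h₁ h₂) (ltLog p h₁ h₂) :=
  isTypedLog_of_functionalEquation
    (functionalEquation_logSeries p _ _ fun k => by simp)
    (by rw [jacobian_X]; exact isUnit_one)

end LubinTateLogarithm

end LubinTateTwo

open MvPowerSeries LubinTateTwo in
theorem proposition3p3 (p : ℕ) [Fact p.Prime] (h₁ h₂ : ℕ) (hh₁ : 0 < h₁) (hh₂ : 0 < h₂)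
    (hcop : Nat.Coprime h₁ h₂)
    (γ : Fin 2 → MvPowerSeries (Fin 2) ℤ_[p])
    (Lγ : Fin 2 → MvPowerSeries (Fin 2) ℚ_[p])
    (hLγ : FunctionalEquation p (ltMatrix p h₁ h₂) γ Lγ)
    (hγ : IsUnit (jacobian γ)) :
    IsCompInverse (ltLog p h₁ h₂) (compInv (ltLog p h₁ h₂)) ∧
    IsCompInverse Lγ (compInv Lγ) ∧
    ∃ (F G : Fin 2 → MvPowerSeries (Fin 2 ⊕ Fin 2) ℤ_[p])
      (φ : Fin 2 → MvPowerSeries (Fin 2) ℤ_[p]),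
      toQp p F = ofLog (ltLog p h₁ h₂) ∧ IsFormalGroup F ∧
      toQp p G = ofLog Lγ ∧ IsFormalGroup G ∧
      toQp p φ = comp (compInv Lγ) (ltLog p h₁ h₂) ∧ IsIso F G φ ∧
      ∀ n : ℕ,
        ∃ (_ : AddCommGroup (torsion p F n)) (_ : Module ℤ_[p] (torsion p F n))
          (_ : AddCommGroup (torsion p G n)) (_ : Module ℤ_[p] (torsion p G n)),
          IsTorsionModule p F (ltLog p h₁ h₂) n ∧ IsTorsionModule p G Lγ n ∧
          ∃ e : torsion p F n ≃ₗ[ℤ_[p]] torsion p G n,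
            ∀ x : torsion p F n, (e x : Fin 2 → PadicAlgCl p) = evalTuple p (toQp p φ) x.1 := by
  have hL := isTypedLog_ltLog p h₁ h₂
  have hL' := isTypedLog_of_functionalEquation hLγ hγ
  obtain ⟨F, hF⟩ := hL.exists_hasLog
  obtain ⟨G, hG⟩ := hL'.exists_hasLog
  -- `L` and `Lγ` share the type `ltMatrix p h₁ h₂`, so the functional equation lemma for `Lγ`
  -- applies to `L` itself.
  obtain ⟨φ, hφ, h⟩ := hL'.exists_logOf_eq hL.hasType
  exact ⟨hL.isCompInverse, hL'.isCompInverse, F, G, φ, hF.toQp_eq hL, hF.isFormalGroup hL,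
    hG.toQp_eq hL', hG.isFormalGroup hL', hL'.toQp_eq_comp_compInv hφ h,
    hL.isIso hL' hF hG hφ h, fun n =>
      LogFormalGroup.exists_torsionModules ⟨_, _, _, F, hL, hF⟩ ⟨_, _, _, G, hL', hG⟩ rfl rfl hφ h n⟩
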